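/- Let $M$ be a paracompact (Hausdorff) smooth manifold of dimension $n$ with a Poisson bracket $\{\,,\}$, i.e. $C^\infty(M)$ is a real Lie algebra under $\{\,,\}$ and each $\mathrm{ad}(f)=\{f,\cdot\}$ is a derivation of the algebra $C^\infty(M)$. Let $A$ be a Weil algebra (a finite-dimensional real commutative unital algebra with a unique maximal ideal $\mathfrak m$, of codimension $1$). Let $M^A$ be the manifold of points infinitely near to $M$ of kind $A$: the algebra homomorphisms $\xi:C^\infty(M)\to A$ for which there is $x\in M$ with $\xi(f)-f(x)\in\mathfrak m$ for all $f$, with the smooth charts $\xi\mapsto(\xi(x_1),\dots,\xi(x_n))\in A^n$ over the charts $(x_1,\dots,x_n)$ of $M$. For $f\in C^\infty(M)$ put $f^A:M^A\to A$, $f^A(\xi)=\xi(f)$, and let $\widetilde{[\mathrm{ad}(f)]^A}$ be the unique $A$-linear derivation of $C^\infty(M^A,A)$ that maps $C^\infty(M^A)$ into itself and sends $g^A$ to $\{f,g\}^A$ for all $g\in C^\infty(M)$. For $p\ge 0$ let $\Lambda^p(M)$ and $\Lambda^p(M^A,\sim)$ be the spaces of skew-symmetric $\mathbb R$-multilinear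 forms of degree $p$ from $C^\infty(M)$ to $C^\infty(M)$ and to $C^\infty(M^A,A)$, respectively. Let $d$ and $\tilde d$ be the Chevalley–Eilenberg operators of the representations $f\mapsto\mathrm{ad}(f)$ and $f\mapsto\widetilde{[\mathrm{ad}(f)]^A}$ of the Lie algebra $C^\infty(M)$: $$(\tilde d\,\Omega)(f_1,\dots,f_{p+1})=\sum_{i=1}^{p+1}(-1)^{i-1}\,\widetilde{[\mathrm{ad}(f_i)]^A}\bigl(\Omega(f_1,\dots,\widehat{f_i},\dots,f_{p+1})\bigr)+\sum_{1\le i<j\le p+1}(-1)^{i+j}\,\Omega(\{f_i,f_j\},f_1,\dots,\widehat{f_i},\dots,\widehat{f_j},\dots,f_{p+1}),$$ and $d$ is given by the same formula with $\mathrm{ad}(f_i)$ in place of $\widetilde{[\mathrm{ad}(f_i)]^A}$. Let $H^p(M)$ and $H^p(M^A,\sim)$ be the quotients of the closed $p$-forms by the exact ones (the only exact $0$-form is $0$). For $\eta\in\Lambda^p(M)$ put $\eta^A(f_1,\dots,f_p)=[\eta(f_1,\dots,f_p)]^A$, so that $\eta^A\in\Lambda^p(M^A,\sim)$. Then: 1.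 if $\eta\in\Lambda^p(M)$, $p\ge 0$, is $d$-closed, then $\eta^A$ is $\tilde d$-closed; 2. if $\eta,\eta'\in\Lambda^{p}(M)$, $p\ge1$, and $\eta-\eta'=d\nu$ with $\nu\in\Lambda^{p-1}(M)$, then $\eta^A-\eta'^A=\tilde d\,\nu^A$; in particular, if $\eta$ and $\eta'$ are cohomologous $d$-closed $p$-forms, then $\eta^A$ and $\eta'^A$ are cohomologous $\tilde d$-closed $p$-forms; 3. hence for every $p\ge0$ there is a unique $\mathbb R$-linear map $H^p(M)\to H^p(M^A,\sim)$ with $[\eta]\mapsto[\eta^A]$ for every $d$-closed $p$-form $\eta$. -/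

import Mathlib

open scoped Manifold ContDiff Topology

/-- A Weil algebra: a real unitary commutative algebra of finite dimension with a unique maximal
ideal, which is of codimension `1`. Below, `A` also carries an algebra norm, which is auxiliary: every Weil algebra
has one, all are equivalent, and only the smooth structure of the finite-dimensional real vector
space `A` is ever used. -/
class IsWeilAlgebra (A : Type*) [CommRing A] [Algebra ℝ A] : Prop extends IsLocalRing A where
  finiteDimensional : FiniteDimensional ℝ A
  codim_eq_one : Module.finrank ℝ (A ⧸ IsLocalRing.maximalIdeal A) = 1

namespace WeilAlgebra

section Algebraic
variable {A : Type*} [CommRing A] [Algebra ℝ A] [IsWeilAlgebra A]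

theorem exists_sub_mem (a : A) :
    ∃ r : ℝ, a - algebraMap ℝ A r ∈ IsLocalRing.maximalIdeal A := by
  have h1 := IsWeilAlgebra.codim_eq_one (A := A)
  have hne : (1 : A ⧸ IsLocalRing.maximalIdeal A) ≠ 0 := one_ne_zero
  obtain ⟨r, hr⟩ := (finrank_eq_one_iff_of_nonzero' _ hne).1 h1 (Ideal.Quotient.mk _ a)
  refine ⟨r, ?_⟩
  rw [← Ideal.Quotient.mk_eq_mk_iff_sub_mem, ← hr, Algebra.smul_def, mul_one]
  rfl

theorem eq_zero_of_algebraMap_mem {r : ℝ}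
    (h : algebraMap ℝ A r ∈ IsLocalRing.maximalIdeal A) : r = 0 := by
  by_contra hr
  exact (IsLocalRing.mem_maximalIdeal _).1 h ((IsUnit.mk0 r hr).map (algebraMap ℝ A))

theorem eq_of_sub_mem {a : A} {r s : ℝ} (hr : a - algebraMap ℝ A r ∈ IsLocalRing.maximalIdeal A)
    (hs : a - algebraMap ℝ A s ∈ IsLocalRing.maximalIdeal A) : r = s := by
  have := Ideal.sub_mem _ hs hr
  rw [sub_sub_sub_cancel_left, ← map_sub] at this
  exact sub_eq_zero.1 (eq_zero_of_algebraMap_mem this)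

variable (A) in
/-- The augmentation `A = ℝ ⊕ 𝔪 → ℝ`. -/
noncomputable def aug : A →ₐ[ℝ] ℝ :=
  AlgHom.ofLinearMap
    { toFun := fun a => (exists_sub_mem a).choose
      map_add' := fun a b => eq_of_sub_mem (exists_sub_mem (a + b)).choose_spec (by
        have := Ideal.add_mem _ (exists_sub_mem a).choose_spec (exists_sub_mem b).choose_spec
        rwa [map_add, add_sub_add_comm])
      map_smul' := fun c a => eq_of_sub_mem (exists_sub_mem (c • a)).choose_spec (by
        have := Ideal.mul_mem_left _ (algebraMap ℝ A c) (exists_sub_mem a).choose_spec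
        simpa [mul_sub, Algebra.smul_def] using this) }
    (eq_of_sub_mem (exists_sub_mem (1 : A)).choose_spec (by simp))
    (fun a b => eq_of_sub_mem (exists_sub_mem (a * b)).choose_spec (by
      have h1 := Ideal.mul_mem_left _ a (exists_sub_mem b).choose_spec
      have h2 := Ideal.mul_mem_left _ (algebraMap ℝ A (exists_sub_mem b).choose)
        (exists_sub_mem a).choose_spec
      have := Ideal.add_mem _ h1 h2
      convert this using 1
      simp only [LinearMap.coe_mk, AddHom.coe_mk, map_mul]
      ring))

theorem sub_aug_mem (a : A) :
    a - algebraMap ℝ A (aug A a) ∈ IsLocalRing.maximalIdeal A := (exists_sub_mem a).choose_spec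

theorem aug_eq_of_sub_mem {a : A} {r : ℝ}
    (h : a - algebraMap ℝ A r ∈ IsLocalRing.maximalIdeal A) : aug A a = r :=
  eq_of_sub_mem (sub_aug_mem a) h

theorem isNilpotent_maximalIdeal : IsNilpotent (IsLocalRing.maximalIdeal A) := by
  have := IsWeilAlgebra.finiteDimensional (A := A)
  have : IsArtinianRing A := IsArtinianRing.of_finite ℝ A
  rw [← IsLocalRing.jacobson_eq_maximalIdeal ⊥ bot_ne_top]
  exact IsArtinianRing.isNilpotent_jacobson_bot

/-- `𝔪 ^ order A = 0`. -/
noncomputable def order (A : Type*) [CommRing A] [Algebra ℝ A] [IsWeilAlgebra A] : ℕ :=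
  nilpotencyClass (IsLocalRing.maximalIdeal A)

theorem maximalIdeal_pow_order : IsLocalRing.maximalIdeal A ^ order A = ⊥ :=
  pow_nilpotencyClass isNilpotent_maximalIdeal

theorem prod_eq_zero {k : ℕ} (hk : order A ≤ k) (ν : Fin k → A)
    (hν : ∀ j, ν j ∈ IsLocalRing.maximalIdeal A) : ∏ j, ν j = 0 := by
  have : ∏ j, ν j ∈ IsLocalRing.maximalIdeal A ^ k := by
    simpa using Ideal.prod_mem_prod (s := Finset.univ) (I := fun _ => IsLocalRing.maximalIdeal A)
      (x := ν) (fun j _ => hν j)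
  have h2 := Ideal.pow_le_pow_right hk this
  rwa [maximalIdeal_pow_order] at h2

end Algebraic

section Analytic
variable {n : ℕ} {A : Type*} [NormedCommRing A] [NormedAlgebra ℝ A]

variable (n A) in
/-- The algebra of smooth functions `ℝⁿ → A`. -/
def smoothSub : Subalgebra ℝ (EuclideanSpace ℝ (Fin n) → A) where
  carrier := {f | ContDiff ℝ ∞ f}
  mul_mem' := fun {f g} (hf : ContDiff ℝ ∞ f) (hg : ContDiff ℝ ∞ g) => hf.mul hg
  add_mem' := fun {f g} (hf : ContDiff ℝ ∞ f) (hg : ContDiff ℝ ∞ g) => hf.add hg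
  algebraMap_mem' := fun r => (contDiff_const (c := algebraMap ℝ A r) :
    ContDiff ℝ ∞ fun _ : EuclideanSpace ℝ (Fin n) => algebraMap ℝ A r)

/-- The standard basis of `ℝⁿ`. -/
noncomputable abbrev eb (n : ℕ) (i : Fin n) : EuclideanSpace ℝ (Fin n) := EuclideanSpace.single i 1

/-- The derivation `∑ νᵢ ∂ᵢ` of the algebra of smooth functions `ℝⁿ → A`. -/
noncomputable def delta (ν : Fin n → A) : Module.End ℝ (smoothSub n A) where
  toFun f := ⟨fun y => ∑ i, ν i * fderiv ℝ f.1 y (eb n i), by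
    have hf : ContDiff ℝ ∞ f.1 := f.2
    have : ContDiff ℝ ∞ (fderiv ℝ f.1) := hf.fderiv_right (by simp)
    exact ContDiff.sum fun i _ => contDiff_const.mul (this.clm_apply contDiff_const)⟩
  map_add' f g := by
    have hf : ContDiff ℝ ∞ f.1 := f.2
    have hg : ContDiff ℝ ∞ g.1 := g.2
    ext y
    have := fderiv_add (hf.differentiable (by simp) y) (hg.differentiable (by simp) y)
    simp [this, mul_add, Finset.sum_add_distrib]
  map_smul' c f := by
    have hf : ContDiff ℝ ∞ f.1 := f.2
    ext y
    have := fderiv_const_smul (hf.differentiable (by simp) y) c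
    simp [this, Finset.smul_sum]

theorem delta_mul (ν : Fin n → A) (f g : smoothSub n A) :
    delta ν (f * g) = f * delta ν g + delta ν f * g := by
  have hf : ContDiff ℝ ∞ f.1 := f.2
  have hg : ContDiff ℝ ∞ g.1 := g.2
  ext y
  have := fderiv_mul (hf.differentiable (by simp) y) (hg.differentiable (by simp) y)
  simp [delta, this, Finset.mul_sum, Finset.sum_mul, ← Finset.sum_add_distrib]
  refine Finset.sum_congr rfl fun i _ => by ring

theorem delta_pow_apply (ν : Fin n → A) (k : ℕ) (f : smoothSub n A)
    (y : EuclideanSpace ℝ (Fin n)) :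
    ((delta ν ^ k) f).1 y = ∑ i : Fin k → Fin n,
      (∏ j, ν (i j)) * iteratedFDeriv ℝ k f.1 y (fun j => eb n (i j)) := by
  induction k generalizing y with
  | zero => simp
  | succ k ih =>
    have hf : ContDiff ℝ ∞ f.1 := f.2
    have hd : ∀ y, DifferentiableAt ℝ (iteratedFDeriv ℝ k f.1) y := fun y =>
      (hf.differentiable_iteratedFDeriv (by exact_mod_cast ENat.natCast_lt_top k)) y
    rw [pow_succ', Module.End.mul_apply]
    have h1 : ((delta ν ^ k) f).1 = fun y => ∑ i : Fin k → Fin n,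
      (∏ j, ν (i j)) * iteratedFDeriv ℝ k f.1 y (fun j => eb n (i j)) := funext ih
    change ∑ i, ν i * fderiv ℝ ((delta ν ^ k) f).1 y (eb n i) = _
    rw [h1]
    have h2 : ∀ v, fderiv ℝ (fun y => ∑ i : Fin k → Fin n,
      (∏ j, ν (i j)) * iteratedFDeriv ℝ k f.1 y (fun j => eb n (i j))) y v
       = ∑ i : Fin k → Fin n, (∏ j, ν (i j)) *
         (fderiv ℝ (iteratedFDeriv ℝ k f.1) y v) (fun j => eb n (i j)) := by
      intro v
      have : HasFDerivAt (fun y => ∑ i : Fin k → Fin n,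
        (∏ j, ν (i j)) * iteratedFDeriv ℝ k f.1 y (fun j => eb n (i j)))
        (∑ i : Fin k → Fin n, (∏ j, ν (i j)) •
         ((ContinuousMultilinearMap.apply ℝ _ A (fun j => eb n (i j))).comp
         (fderiv ℝ (iteratedFDeriv ℝ k f.1) y))) y := by
        refine HasFDerivAt.fun_sum fun i _ => ?_
        refine HasFDerivAt.const_mul ?_ _
        exact (ContinuousMultilinearMap.apply ℝ _ A (fun j => eb n (i j))).hasFDerivAt.comp y
          (hd y).hasFDerivAt
      rw [this.fderiv]
      simp
    simp_rw [h2]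
    rw [← (Fin.consEquiv (fun _ => Fin n)).sum_comp, Fintype.sum_prod_type]
    refine Finset.sum_congr rfl fun a _ => ?_
    rw [Finset.mul_sum]
    refine Finset.sum_congr rfl fun i _ => ?_
    rw [iteratedFDeriv_succ_apply_left, Fin.prod_univ_succ]
    simp [Fin.consEquiv, mul_assoc]
    rfl


/-- The `ℚ`-module structure needed for `IsNilpotent.exp`. -/
@[reducible] noncomputable def ratModule : Module ℚ (smoothSub n A) :=
  Module.compHom _ (algebraMap ℚ ℝ)

attribute [local instance] ratModule

theorem exp_apply_of_pow {L : Module.End ℝ (smoothSub n A)} {f : smoothSub n A}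
    (hL : IsNilpotent L) (h : L (L f) = 0) : IsNilpotent.exp L f = f + L f := by
  have := IsNilpotent.exp_smul_eq_sum (a := L) (m := f) (k := 2) (by simpa [pow_two] using h) hL
  simpa [Finset.sum_range_succ] using this

variable [IsWeilAlgebra A]

theorem delta_isNilpotent {ν : Fin n → A} (hν : ∀ i, ν i ∈ IsLocalRing.maximalIdeal A)
    {k : ℕ} (hk : order A ≤ k) : delta ν ^ k = 0 := by
  ext f y
  rw [delta_pow_apply]
  simp only [LinearMap.zero_apply, ZeroMemClass.coe_zero, Pi.zero_apply]
  exact Finset.sum_eq_zero fun i _ => by rw [prod_eq_zero hk _ fun j => hν _, zero_mul]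

/-- The image of `c ∈ Aⁿ` in `ℝⁿ` under the augmentation. -/
noncomputable def base (c : Fin n → A) : EuclideanSpace ℝ (Fin n) :=
  WithLp.toLp 2 fun i => aug A (c i)

/-- The nilpotent part of `c ∈ Aⁿ`. -/
noncomputable def nil (c : Fin n → A) (i : Fin n) : A := c i - algebraMap ℝ A (aug A (c i))

theorem nil_mem (c : Fin n → A) (i : Fin n) : nil c i ∈ IsLocalRing.maximalIdeal A :=
  sub_aug_mem _

/-- The value at `c = a + ν ∈ Aⁿ = ℝⁿ ⊕ 𝔪ⁿ` of the extension of `G : ℝⁿ → ℝ` by its Taylor formula,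
`∑ₖ (1 / k!) DᵏG(a)(ν, …, ν)`; it only depends on the germ of `G` at `a`. -/
noncomputable def weilExt (G : EuclideanSpace ℝ (Fin n) → ℝ) (c : Fin n → A) : A :=
  ∑ k ∈ Finset.range (order A), (k.factorial : ℝ)⁻¹ • ∑ i : Fin k → Fin n,
    iteratedFDeriv ℝ k G (base c) (fun j => eb n (i j)) • ∏ j, nil c (i j)

theorem weilExt_congr {G G' : EuclideanSpace ℝ (Fin n) → ℝ} {c : Fin n → A}
    (h : G =ᶠ[𝓝 (base c)] G') : weilExt G c = weilExt G' c := by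
  unfold weilExt
  simp_rw [fun k => (h.iteratedFDeriv ℝ k).eq_of_nhds]

variable (A) in
/-- A real smooth function as an `A`-valued one. -/
noncomputable def toSub (G : EuclideanSpace ℝ (Fin n) → ℝ) (hG : ContDiff ℝ ∞ G) :
    smoothSub n A :=
  ⟨fun y => algebraMap ℝ A (G y), (algebraMapCLM ℝ A).contDiff.comp hG⟩

theorem weilExt_eq_exp {G : EuclideanSpace ℝ (Fin n) → ℝ} (hG : ContDiff ℝ ∞ G)
    (c : Fin n → A) :
    weilExt G c = (IsNilpotent.exp (delta (nil c)) (toSub A G hG)).1 (base c) := by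
  rw [IsNilpotent.exp_eq_sum (delta_isNilpotent (nil_mem c) le_rfl), weilExt]
  simp only [LinearMap.sum_apply, AddSubmonoidClass.coe_finsetSum, Finset.sum_apply]
  refine Finset.sum_congr rfl fun k _ => ?_
  have h1 : ((((k.factorial : ℚ)⁻¹ • delta (nil c) ^ k) (toSub A G hG)).1 (base c)) =
      (k.factorial : ℝ)⁻¹ • ((delta (nil c) ^ k) (toSub A G hG)).1 (base c) := by
    change (algebraMap ℚ ℝ (k.factorial : ℚ)⁻¹) • ((delta (nil c) ^ k) (toSub A G hG)).1 (base c)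
      = _
    simp
  rw [h1, delta_pow_apply]
  congr 1
  refine Finset.sum_congr rfl fun i _ => ?_
  have := (algebraMapCLM ℝ A).iteratedFDeriv_comp_left (hG.contDiffAt (x := base c))
    (i := k) (by exact_mod_cast le_top)
  have h2 : (toSub A G hG).1 = algebraMapCLM ℝ A ∘ G := rfl
  rw [h2, this]
  simp [Algebra.smul_def, mul_comm]

theorem weilExt_mul {G H : EuclideanSpace ℝ (Fin n) → ℝ} (hG : ContDiff ℝ ∞ G)
    (hH : ContDiff ℝ ∞ H) (c : Fin n → A) :
    weilExt (G * H) c = weilExt G c * weilExt H c := by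
  have h : toSub A (G * H) (hG.mul hH) = toSub A G hG * toSub A H hH := by
    ext y; simp [toSub]
  rw [weilExt_eq_exp hG, weilExt_eq_exp hH, weilExt_eq_exp (G := G * H) (hG.mul hH), h,
    Module.End.exp_mul_of_derivation ℝ _ _ (delta_mul (nil c))
      ⟨_, delta_isNilpotent (nil_mem c) le_rfl⟩]
  rfl

theorem weilExt_add {G H : EuclideanSpace ℝ (Fin n) → ℝ} (hG : ContDiff ℝ ∞ G)
    (hH : ContDiff ℝ ∞ H) (c : Fin n → A) :
    weilExt (G + H) c = weilExt G c + weilExt H c := by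
  have h : toSub A (G + H) (hG.add hH) = toSub A G hG + toSub A H hH := by
    ext y; simp [toSub]
  rw [weilExt_eq_exp hG, weilExt_eq_exp hH, weilExt_eq_exp (G := G + H) (hG.add hH), h, map_add]
  rfl

theorem weilExt_const (r : ℝ) (c : Fin n → A) :
    weilExt (fun _ => r) c = algebraMap ℝ A r := by
  have h : delta (nil c) (toSub A (fun _ => r) contDiff_const) = 0 := by
    ext y; simp [delta, toSub]
  rw [weilExt_eq_exp contDiff_const,
    exp_apply_of_pow ⟨_, delta_isNilpotent (nil_mem c) le_rfl⟩ (by rw [h, map_zero]), h, add_zero]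
  rfl

theorem weilExt_coord (i : Fin n) (c : Fin n → A) :
    weilExt (fun y => y i) c = c i := by
  have hs : ContDiff ℝ ∞ fun y : EuclideanSpace ℝ (Fin n) => y i :=
    (EuclideanSpace.proj (𝕜 := ℝ) i).contDiff
  have h : ∀ y, (delta (nil c) (toSub A (fun y => y i) hs)).1 y = nil c i := by
    intro y
    have : HasFDerivAt (fun y : EuclideanSpace ℝ (Fin n) => algebraMap ℝ A (y i))
      ((algebraMapCLM ℝ A).comp (EuclideanSpace.proj (𝕜 := ℝ) i)) y :=
        ((algebraMapCLM ℝ A).comp (EuclideanSpace.proj (𝕜 := ℝ) i)).hasFDerivAt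
    simp [delta, toSub, this.fderiv, Finset.sum_ite_eq]
  have h2 : delta (nil c) (delta (nil c) (toSub A (fun y => y i) hs)) = 0 := by
    ext y
    change ∑ j, nil c j * fderiv ℝ (delta (nil c) (toSub A (fun y => y i) hs)).1 y (eb n j) = 0
    rw [show (delta (nil c) (toSub A (fun y => y i) hs)).1 = fun _ => nil c i from funext h]
    simp
  rw [weilExt_eq_exp hs, exp_apply_of_pow ⟨_, delta_isNilpotent (nil_mem c) le_rfl⟩ h2]
  change _ + (delta (nil c) (toSub A (fun y => y i) hs)).1 _ = _
  rw [h]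
  simp [toSub, base, nil]

theorem weilExt_sub_mem {G : EuclideanSpace ℝ (Fin n) → ℝ} (c : Fin n → A) :
    weilExt G c - algebraMap ℝ A (G (base c)) ∈ IsLocalRing.maximalIdeal A := by
  have hpos : 0 < order A := by
    rw [Nat.pos_iff_ne_zero]
    intro h
    have := maximalIdeal_pow_order (A := A)
    rw [h, pow_zero, Ideal.one_eq_top] at this
    exact top_ne_bot this
  rw [weilExt, ← Finset.sum_erase_add _ _ (Finset.mem_range.2 hpos)]
  simp only [Nat.factorial_zero, Nat.cast_one, inv_one, one_smul, Finset.univ_unique,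
    iteratedFDeriv_zero_apply, Finset.univ_eq_empty, Finset.prod_empty, Finset.sum_const,
    Finset.card_singleton, Algebra.algebraMap_eq_smul_one]
  rw [add_sub_cancel_right]
  refine Ideal.sum_mem _ fun k hk => ?_
  refine Submodule.smul_of_tower_mem _ _ (Ideal.sum_mem _ fun i _ => ?_)
  refine Submodule.smul_of_tower_mem _ _ ?_
  obtain ⟨k, rfl⟩ := Nat.exists_eq_succ_of_ne_zero (Finset.ne_of_mem_erase hk)
  rw [Fin.prod_univ_succ]
  exact Ideal.mul_mem_right _ _ (nil_mem _ _)

theorem contDiff_base : ContDiff ℝ ∞ (base : (Fin n → A) → _) := by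
  have := IsWeilAlgebra.finiteDimensional (A := A)
  have : ContDiff ℝ ∞ fun a : A => aug A a :=
    (LinearMap.toContinuousLinearMap (aug A).toLinearMap).contDiff
  exact contDiff_euclidean.2 fun i => this.comp (contDiff_apply ℝ A i)

theorem contDiff_nil (i : Fin n) : ContDiff ℝ ∞ fun c : Fin n → A => nil c i := by
  have := IsWeilAlgebra.finiteDimensional (A := A)
  have : ContDiff ℝ ∞ fun a : A => aug A a :=
    (LinearMap.toContinuousLinearMap (aug A).toLinearMap).contDiff
  have h2 := this.comp (contDiff_apply ℝ A i : ContDiff ℝ ∞ fun c : Fin n → A => c i)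
  exact (contDiff_apply ℝ A i).sub ((algebraMapCLM ℝ A).contDiff.comp h2)

theorem contDiffOn_weilExt {G : EuclideanSpace ℝ (Fin n) → ℝ} {U : Set (EuclideanSpace ℝ (Fin n))}
    (hU : IsOpen U) (hG : ContDiffOn ℝ ∞ G U) :
    ContDiffOn ℝ ∞ (weilExt G : (Fin n → A) → A) (base ⁻¹' U) := by
  intro c hc
  refine ContDiffAt.contDiffWithinAt ?_
  refine ContDiffAt.sum fun k _ => ContDiffAt.const_smul _ (ContDiffAt.sum fun i _ => ?_)
  have h1 : ContDiffAt ℝ ∞ (iteratedFDeriv ℝ k G) (base c) :=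
    ((hG.contDiffAt (hU.mem_nhds hc)).iteratedFDeriv_right (m := ∞) (by exact_mod_cast le_top))
  have h2 := h1.comp c contDiff_base.contDiffAt
  have h3 := (ContinuousMultilinearMap.apply ℝ (fun _ : Fin k => EuclideanSpace ℝ (Fin n)) ℝ
    (fun j => eb n (i j))).contDiff.contDiffAt.comp (n := ∞) c h2
  have h4 : ContDiffAt ℝ ∞ (fun c : Fin n → A => ∏ j, nil c (i j)) c :=
    contDiffAt_prod fun j _ => (contDiff_nil _).contDiffAt
  exact h3.smul h4

end Analytic
end WeilAlgebra

namespace WeilAlgebra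
section Hadamard
variable {n : ℕ}
open MeasureTheory

theorem contDiff_integral {Φ : EuclideanSpace ℝ (Fin n) × ℝ → ℝ} (hΦ : ContDiff ℝ ∞ Φ) :
    ContDiff ℝ ∞ fun y => ∫ t in (0 : ℝ)..1, Φ (y, t) := by
  let χ : ContDiffBump (0 : ℝ) := ⟨2, 3, by norm_num, by norm_num⟩
  let f : ℝ → ℝ := (Set.Ioc (0 : ℝ) 1).indicator fun _ => 1
  let g : EuclideanSpace ℝ (Fin n) → ℝ → ℝ := fun y s => χ s * Φ (y, -s)
  have hf : LocallyIntegrable f volume :=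
    ((integrable_indicator_iff measurableSet_Ioc).2 (by simp)).locallyIntegrable
  have hg : ContDiffOn ℝ ∞ (Function.HasUncurry.uncurry g) (Set.univ ×ˢ Set.univ) := by
    refine ContDiff.contDiffOn ?_
    refine ContDiff.mul (χ.contDiff.comp contDiff_snd) (hΦ.comp ?_)
    exact contDiff_fst.prodMk contDiff_snd.neg
  have := contDiffOn_convolution_right_with_param_comp (n := ⊤) (μ := volume)
    (ContinuousLinearMap.mul ℝ ℝ) (v := fun _ => (0 : ℝ)) contDiffOn_const (f := f) (g := g)
    isOpen_univ (isCompact_closedBall (0 : ℝ) 3) (fun p x _ hx => by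
      have : χ x = 0 := by
        apply Function.notMem_support.1
        rw [χ.support_eq]
        exact fun h => hx (Metric.ball_subset_closedBall h)
      simp [g, this]) hf hg
  rw [contDiffOn_univ] at this
  convert this using 2 with y
  rw [convolution, intervalIntegral.integral_of_le zero_le_one,
    ← integral_indicator measurableSet_Ioc]
  refine integral_congr_ae (Filter.Eventually.of_forall fun t => ?_)
  by_cases ht : t ∈ Set.Ioc (0 : ℝ) 1
  · have : χ (-t) = 1 := χ.one_of_mem_closedBall (by
      simp only [χ, Metric.mem_closedBall, dist_zero_right, norm_neg, Real.norm_eq_abs]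
      rw [abs_of_pos ht.1]; linarith [ht.2])
    simp [f, g, ht, this]
  · simp [f, ht]

theorem hadamard {G : EuclideanSpace ℝ (Fin n) → ℝ} (hG : ContDiff ℝ ∞ G)
    (a : EuclideanSpace ℝ (Fin n)) :
    ∃ g : Fin n → EuclideanSpace ℝ (Fin n) → ℝ, (∀ i, ContDiff ℝ ∞ (g i)) ∧
      ∀ y, G y = G a + ∑ i, (y i - a i) * g i y := by
  have hG' : ContDiff ℝ ∞ (fderiv ℝ G) := hG.fderiv_right (by simp)
  have hΦ : ∀ i, ContDiff ℝ ∞ fun p : EuclideanSpace ℝ (Fin n) × ℝ =>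
      fderiv ℝ G (a + p.2 • (p.1 - a)) (eb n i) := fun i =>
    (hG'.comp (contDiff_const.add (contDiff_snd.smul (contDiff_fst.sub contDiff_const)))).clm_apply
      contDiff_const
  refine ⟨fun i y => ∫ t in (0 : ℝ)..1, fderiv ℝ G (a + t • (y - a)) (eb n i),
    fun i => contDiff_integral (hΦ i), fun y => ?_⟩
  have hd : ∀ t : ℝ, HasDerivAt (fun t : ℝ => G (a + t • (y - a)))
      (∑ i, (y i - a i) * fderiv ℝ G (a + t • (y - a)) (eb n i)) t := by
    intro t
    have h1 : HasDerivAt (fun t : ℝ => a + t • (y - a)) (y - a) t := by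
      simpa using ((hasDerivAt_id t).smul_const (y - a)).const_add a
    have h2 := ((hG.differentiable (by simp)) (a + t • (y - a))).hasFDerivAt.comp_hasDerivAt t h1
    have h3 : y - a = ∑ i, (y i - a i) • eb n i := by
      ext j; simp [Pi.single_apply]
    have h4 : fderiv ℝ G (a + t • (y - a)) (y - a) =
        ∑ i, (y i - a i) * fderiv ℝ G (a + t • (y - a)) (eb n i) := by
      generalize fderiv ℝ G (a + t • (y - a)) = L
      rw [h3, map_sum]
      simp only [map_smul, smul_eq_mul]
    rw [← h4]
    exact h2
  have hc : ∀ i, Continuous fun t : ℝ => (y i - a i) * fderiv ℝ G (a + t • (y - a)) (eb n i) :=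
    fun i => continuous_const.mul ((hΦ i).continuous.comp (Continuous.prodMk_right y))
  have := intervalIntegral.integral_eq_sub_of_hasDerivAt (a := 0) (b := 1) (fun t _ => hd t)
    ((continuous_finsetSum _ fun i _ => hc i).intervalIntegrable _ _)
  rw [intervalIntegral.integral_finsetSum fun i _ => (hc i).intervalIntegrable _ _] at this
  simp only [intervalIntegral.integral_const_mul, one_smul, zero_smul, add_zero,
    add_sub_cancel] at this
  linarith
end Hadamard
end WeilAlgebra

noncomputable section

/-- `C^∞(M)`. -/
abbrev SmoothFun (n : ℕ) (M : Type*) [TopologicalSpace M]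
    [ChartedSpace (EuclideanSpace ℝ (Fin n)) M] : Type _ := C^∞⟮𝓡 n, M; 𝓘(ℝ, ℝ), ℝ⟯

/-- The set `M^A` of the points infinitely near to points of `M` of kind `A`: the homomorphisms of
algebras `ξ : C^∞(M) → A` such that, for some `x` in `M`, `ξ(f) - f(x) ∈ 𝔪` for every `f`. -/
@[ext]
structure WeilBundle (n : ℕ) (M : Type*) [TopologicalSpace M]
    [ChartedSpace (EuclideanSpace ℝ (Fin n)) M] (A : Type*) [CommRing A] [Algebra ℝ A]
    [IsWeilAlgebra A] where
  toAlgHom : SmoothFun n M →ₐ[ℝ] A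
  exists_origin : ∃ x : M, ∀ f : SmoothFun n M,
    toAlgHom f - algebraMap ℝ A (f x) ∈ IsLocalRing.maximalIdeal A

namespace WeilBundle
open WeilAlgebra

section Local
variable {n : ℕ} {M : Type*} [TopologicalSpace M] [ChartedSpace (EuclideanSpace ℝ (Fin n)) M]

section NoT2
variable [IsManifold (𝓡 n) ∞ M]

theorem contMDiffOn_coord {e : OpenPartialHomeomorph M (EuclideanSpace ℝ (Fin n))}
    (he : e ∈ atlas (EuclideanSpace ℝ (Fin n)) M) (i : Fin n) :
    ContMDiffOn (𝓡 n) 𝓘(ℝ, ℝ) ∞ (fun y => e y i) e.source := by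
  have h1 := contMDiffOn_of_mem_maximalAtlas (I := 𝓡 n) (n := ∞)
    (IsManifold.subset_maximalAtlas he)
  have h2 : ContMDiff 𝓘(ℝ, EuclideanSpace ℝ (Fin n)) 𝓘(ℝ, ℝ) ∞
    fun y : EuclideanSpace ℝ (Fin n) => y i :=
    (EuclideanSpace.proj (𝕜 := ℝ) i).contDiff.contMDiff
  exact h2.comp_contMDiffOn h1

theorem contDiffOn_comp_symm {e : OpenPartialHomeomorph M (EuclideanSpace ℝ (Fin n))}
    (he : e ∈ atlas (EuclideanSpace ℝ (Fin n)) M) {h : M → ℝ} {U : Set M}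
    (hh : ContMDiffOn (𝓡 n) 𝓘(ℝ, ℝ) ∞ h U) :
    ContDiffOn ℝ ∞ (h ∘ e.symm) (e.target ∩ e.symm ⁻¹' U) := by
  have h1 := contMDiffOn_symm_of_mem_maximalAtlas (I := 𝓡 n) (n := ∞)
    (IsManifold.subset_maximalAtlas he)
  exact (hh.comp (h1.mono Set.inter_subset_left) fun y hy => hy.2).contDiffOn

end NoT2

theorem exists_extension [T2Space M] [IsManifold (𝓡 n) ∞ M] {x : M} {h : M → ℝ} {U : Set M} (hU : IsOpen U)
    (hx : x ∈ U) (hh : ContMDiffOn (𝓡 n) 𝓘(ℝ, ℝ) ∞ h U) :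
    ∃ f : SmoothFun n M, f =ᶠ[𝓝 x] h := by
  obtain ⟨b, -, hb⟩ := ((SmoothBumpFunction.nhds_basis_tsupport (I := 𝓡 n) x).mem_iff).1
    (hU.mem_nhds hx)
  refine ⟨⟨fun y => b y * h y, contMDiff_of_tsupport fun y hy => ?_⟩, ?_⟩
  · have hyU : y ∈ U := hb (closure_mono (Function.support_mul_subset_left _ _) hy)
    exact b.contMDiff.contMDiffAt.mul (hh.contMDiffAt (hU.mem_nhds hyU))
  · filter_upwards [b.eventuallyEq_one] with y hy
    simp [hy]

variable {A : Type*} [CommRing A] [Algebra ℝ A] [IsWeilAlgebra A]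

/-- The point `x` of `M` to which `ξ` is infinitely near. -/
def origin (ξ : WeilBundle n M A) : M := ξ.exists_origin.choose

theorem sub_origin_mem (ξ : WeilBundle n M A) (f : SmoothFun n M) :
    ξ.toAlgHom f - algebraMap ℝ A (f ξ.origin) ∈ IsLocalRing.maximalIdeal A :=
  ξ.exists_origin.choose_spec f

variable [T2Space M] [IsManifold (𝓡 n) ∞ M]

theorem origin_eq {ξ : WeilBundle n M A} {x : M} (h : ∀ f : SmoothFun n M,
    ξ.toAlgHom f - algebraMap ℝ A (f x) ∈ IsLocalRing.maximalIdeal A) : ξ.origin = x := by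
  by_contra hne
  obtain ⟨U, V, hU, hV, hxU, hxV, hd⟩ := t2_separation (Ne.symm hne)
  obtain ⟨b, -, hb⟩ := ((SmoothBumpFunction.nhds_basis_tsupport (I := 𝓡 n) x).mem_iff).1
    (hU.mem_nhds hxU)
  have h1 := eq_of_sub_mem (h ⟨b, b.contMDiff⟩) (ξ.sub_origin_mem ⟨b, b.contMDiff⟩)
  have h2 : b ξ.origin = 0 := image_eq_zero_of_notMem_tsupport
    fun hm => Set.disjoint_left.1 hd (hb hm) hxV
  have h3 : b x = 1 := b.eq_one
  change b x = b ξ.origin at h1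
  rw [h2, h3] at h1
  exact one_ne_zero h1

theorem apply_congr (ξ : WeilBundle n M A) {f g : SmoothFun n M} (h : f =ᶠ[𝓝 ξ.origin] g) :
    ξ.toAlgHom f = ξ.toAlgHom g := by
  obtain ⟨U, hU, hUo, hxU⟩ := eventually_nhds_iff.1 h
  obtain ⟨b, -, hb⟩ := ((SmoothBumpFunction.nhds_basis_tsupport (I := 𝓡 n) ξ.origin).mem_iff).1
    (hUo.mem_nhds hxU)
  let B : SmoothFun n M := ⟨b, b.contMDiff⟩
  have h0 : (f - g) * B = 0 := by
    ext y
    change (f y - g y) * b y = 0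
    by_cases hy : y ∈ tsupport b
    · rw [hU y (hb hy), sub_self, zero_mul]
    · rw [image_eq_zero_of_notMem_tsupport hy, mul_zero]
  have h1 := congrArg ξ.toAlgHom h0
  rw [map_mul, map_sub, map_zero] at h1
  have hu : IsUnit (ξ.toAlgHom B) := by
    by_contra hn
    have h2 := ξ.sub_origin_mem B
    have h3 := Ideal.sub_mem _ ((IsLocalRing.mem_maximalIdeal _).2 hn) h2
    rw [sub_sub_cancel] at h3
    have h4 := eq_zero_of_algebraMap_mem h3
    have h5 : b ξ.origin = 1 := b.eq_one
    exact one_ne_zero (h5.symm.trans h4)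
  exact sub_eq_zero.1 (hu.mul_left_eq_zero.1 h1)

open Classical in
/-- The value `ξ(h)` for a function `h` that is smooth near the origin of `ξ`: it is `ξ(f)` for any
`f ∈ C^∞(M)` with the same germ as `h` at the origin of `ξ`. -/
def localEval (ξ : WeilBundle n M A) (h : M → ℝ) : A :=
  if H : ∃ f : SmoothFun n M, f =ᶠ[𝓝 ξ.origin] h then ξ.toAlgHom H.choose else 0

theorem localEval_eq (ξ : WeilBundle n M A) {h : M → ℝ} {f : SmoothFun n M}
    (hf : f =ᶠ[𝓝 ξ.origin] h) : ξ.localEval h = ξ.toAlgHom f := by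
  have H : ∃ f : SmoothFun n M, f =ᶠ[𝓝 ξ.origin] h := ⟨f, hf⟩
  rw [localEval, dif_pos H]
  exact ξ.apply_congr (H.choose_spec.trans hf.symm)

theorem exists_contDiff_extension {U : Set (EuclideanSpace ℝ (Fin n))} (hU : IsOpen U)
    {G : EuclideanSpace ℝ (Fin n) → ℝ} (hG : ContDiffOn ℝ ∞ G U) {a : EuclideanSpace ℝ (Fin n)}
    (ha : a ∈ U) : ∃ G' : EuclideanSpace ℝ (Fin n) → ℝ, ContDiff ℝ ∞ G' ∧ G' =ᶠ[𝓝 a] G := by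
  obtain ⟨f, hf⟩ := exists_extension hU ha hG.contMDiffOn
  exact ⟨f, f.contMDiff.contDiff, hf⟩

/-- Near points are determined by their values on the coordinates. -/
theorem ext_of_coord {e : OpenPartialHomeomorph M (EuclideanSpace ℝ (Fin n))}
    (he : e ∈ atlas (EuclideanSpace ℝ (Fin n)) M) {ξ ξ' : WeilBundle n M A}
    {x : M} (hx : ξ.origin = x) (hx' : ξ'.origin = x) (hs : x ∈ e.source)
    (hc : ∀ i, ξ.localEval (fun y => e y i) = ξ'.localEval fun y => e y i) : ξ = ξ' := by
  have key : ∀ k : ℕ, ∀ f : SmoothFun n M,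
      ξ.toAlgHom f - ξ'.toAlgHom f ∈ IsLocalRing.maximalIdeal A ^ k := by
    intro k
    induction k with
    | zero => simp
    | succ k ih =>
      intro f
      obtain ⟨G, hG, hGf⟩ := exists_contDiff_extension (e.open_target.inter (by simp))
        (contDiffOn_comp_symm he (f.contMDiff.contMDiffOn (s := Set.univ)))
        (⟨e.map_source hs, Set.mem_univ _⟩ : e x ∈ e.target ∩ e.symm ⁻¹' Set.univ)
      obtain ⟨g, hg, hGg⟩ := hadamard hG (e x)
      have hge : ∀ i, ∃ q : SmoothFun n M, q =ᶠ[𝓝 x] fun y => g i (e y) := fun i =>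
        exists_extension e.open_source hs ((hg i).contMDiff.comp_contMDiffOn
          (contMDiffOn_of_mem_maximalAtlas (I := 𝓡 n) (n := ∞) (IsManifold.subset_maximalAtlas he)))
      choose q hq using hge
      choose X hX using fun i => exists_extension e.open_source hs (contMDiffOn_coord he i)
      obtain ⟨R, hR⟩ : ∃ R : SmoothFun n M, R = algebraMap ℝ (SmoothFun n M) (G (e x)) +
          ∑ i, (X i - algebraMap ℝ (SmoothFun n M) (e x i)) * q i := ⟨_, rfl⟩
      have hf : f =ᶠ[𝓝 x] R := by
        have h1 : ∀ᶠ y in 𝓝 x, G (e y) = f (e.symm (e y)) :=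
          (e.continuousAt hs).eventually hGf
        filter_upwards [h1, e.open_source.mem_nhds hs, Filter.eventually_all.2 hq,
          Filter.eventually_all.2 hX] with y hy1 hy2 hy3 hy4
        rw [e.left_inv hy2, hGg] at hy1
        rw [← hy1]
        have hsum : ∀ (F : Fin n → SmoothFun n M) (y : M), (∑ i, F i) y = ∑ i, F i y := fun F y =>
          map_sum (ContMDiffMap.evalRingHom y) F _
        rw [hR, ContMDiffMap.coe_add, Pi.add_apply, hsum]
        refine congrArg₂ _ rfl (Finset.sum_congr rfl fun i _ => ?_)
        rw [← hy3 i, ← hy4 i]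
        rfl
      have hX' : ∀ i, ξ.toAlgHom (X i) = ξ'.toAlgHom (X i) := fun i => by
        rw [← localEval_eq ξ (hx ▸ hX i), ← localEval_eq ξ' (hx' ▸ hX i), hc]
      rw [ξ.apply_congr (g := R) (by rw [hx]; exact hf),
        ξ'.apply_congr (g := R) (by rw [hx']; exact hf), hR]
      simp only [map_add, map_sum, map_mul, map_sub, AlgHom.commutes, hX']
      rw [add_sub_add_left_eq_sub, ← Finset.sum_sub_distrib]
      simp only [← mul_sub]
      refine Ideal.sum_mem _ fun i _ => ?_
      rw [pow_succ']
      refine Ideal.mul_mem_mul ?_ (ih _)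
      have := ξ.sub_origin_mem (X i)
      rwa [hx, (hX i).eq_of_nhds, hX'] at this
  ext f
  have := key (order A) f
  rw [maximalIdeal_pow_order] at this
  exact sub_eq_zero.1 this
end Local
end WeilBundle

namespace WeilBundle
open WeilAlgebra

section Charts
variable {n : ℕ} {M : Type*} [TopologicalSpace M] [ChartedSpace (EuclideanSpace ℝ (Fin n)) M]

/-- The point `f ↦ f x` of `M^A`. -/
def const (A : Type*) [CommRing A] [Algebra ℝ A] [IsWeilAlgebra A] (x : M) : WeilBundle n M A where
  toAlgHom :=
    { toFun := fun f => algebraMap ℝ A (f x)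
      map_one' := map_one _
      map_mul' := fun _ _ => map_mul _ _ _
      map_zero' := map_zero _
      map_add' := fun _ _ => map_add _ _ _
      commutes' := fun _ => rfl }
  exists_origin := ⟨x, fun f => by
    change algebraMap ℝ A (f x) - algebraMap ℝ A (f x) ∈ _
    rw [sub_self]
    exact Ideal.zero_mem _⟩

variable [T2Space M] [IsManifold (𝓡 n) ∞ M]
  {A : Type*} [NormedCommRing A] [NormedAlgebra ℝ A] [IsWeilAlgebra A]

theorem exists_ext_comp_symm {e : OpenPartialHomeomorph M (EuclideanSpace ℝ (Fin n))}
    (he : e ∈ atlas (EuclideanSpace ℝ (Fin n)) M) {a : EuclideanSpace ℝ (Fin n)}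
    (ha : a ∈ e.target) (f : SmoothFun n M) :
    ∃ G : EuclideanSpace ℝ (Fin n) → ℝ, ContDiff ℝ ∞ G ∧ G =ᶠ[𝓝 a] f ∘ e.symm :=
  exists_contDiff_extension (e.open_target.inter (by simp))
    (contDiffOn_comp_symm he (f.contMDiff.contMDiffOn (s := Set.univ))) ⟨ha, Set.mem_univ _⟩

/-- The point of `M^A` with coordinates `c` in the chart `e`. -/
def ofCoord (e : OpenPartialHomeomorph M (EuclideanSpace ℝ (Fin n)))
    (he : e ∈ atlas (EuclideanSpace ℝ (Fin n)) M) (c : Fin n → A) (hc : base c ∈ e.target) :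
    WeilBundle n M A where
  toAlgHom :=
    { toFun := fun f => weilExt (f ∘ e.symm) c
      map_one' := (weilExt_const 1 c).trans (map_one _)
      map_mul' := fun f g => by
        obtain ⟨F, hF, hFf⟩ := exists_ext_comp_symm he hc f
        obtain ⟨G, hG, hGg⟩ := exists_ext_comp_symm he hc g
        rw [← weilExt_congr hFf, ← weilExt_congr hGg, ← weilExt_mul hF hG]
        exact (weilExt_congr (hFf.mul hGg)).symm
      map_zero' := (weilExt_const 0 c).trans (map_zero _)
      map_add' := fun f g => by
        obtain ⟨F, hF, hFf⟩ := exists_ext_comp_symm he hc f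
        obtain ⟨G, hG, hGg⟩ := exists_ext_comp_symm he hc g
        rw [← weilExt_congr hFf, ← weilExt_congr hGg, ← weilExt_add hF hG]
        exact (weilExt_congr (hFf.add hGg)).symm
      commutes' := fun r => weilExt_const r c }
  exists_origin := ⟨e.symm (base c), fun _ => weilExt_sub_mem c⟩

theorem ofCoord_apply {e : OpenPartialHomeomorph M (EuclideanSpace ℝ (Fin n))}
    (he : e ∈ atlas (EuclideanSpace ℝ (Fin n)) M) {c : Fin n → A} (hc : base c ∈ e.target)
    (f : SmoothFun n M) : (ofCoord e he c hc).toAlgHom f = weilExt (f ∘ e.symm) c := rfl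

theorem origin_ofCoord {e : OpenPartialHomeomorph M (EuclideanSpace ℝ (Fin n))}
    (he : e ∈ atlas (EuclideanSpace ℝ (Fin n)) M) {c : Fin n → A} (hc : base c ∈ e.target) :
    (ofCoord e he c hc).origin = e.symm (base c) := origin_eq fun _ => weilExt_sub_mem c

theorem localEval_ofCoord {e e' : OpenPartialHomeomorph M (EuclideanSpace ℝ (Fin n))}
    (he : e ∈ atlas (EuclideanSpace ℝ (Fin n)) M) (he' : e' ∈ atlas (EuclideanSpace ℝ (Fin n)) M)
    {c : Fin n → A} (hc : base c ∈ e.target) (hc' : e.symm (base c) ∈ e'.source) (i : Fin n) :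
    (ofCoord e he c hc).localEval (fun y => e' y i) = weilExt (fun y => e' (e.symm y) i) c := by
  obtain ⟨f, hf⟩ := exists_extension e'.open_source hc' (contMDiffOn_coord he' i)
  rw [localEval_eq (f := f) _ (by rw [origin_ofCoord]; exact hf), ofCoord_apply]
  exact weilExt_congr ((e.continuousAt_symm hc).eventually hf)

theorem localEval_ofCoord_self {e : OpenPartialHomeomorph M (EuclideanSpace ℝ (Fin n))}
    (he : e ∈ atlas (EuclideanSpace ℝ (Fin n)) M) {c : Fin n → A} (hc : base c ∈ e.target)
    (i : Fin n) : (ofCoord e he c hc).localEval (fun y => e y i) = c i := by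
  rw [localEval_ofCoord he he hc (e.map_target hc)]
  refine Eq.trans (weilExt_congr ?_) (weilExt_coord i c)
  filter_upwards [e.open_target.mem_nhds hc] with y hy
  rw [e.right_inv hy]

theorem base_localEval {e : OpenPartialHomeomorph M (EuclideanSpace ℝ (Fin n))}
    (he : e ∈ atlas (EuclideanSpace ℝ (Fin n)) M) {ξ : WeilBundle n M A}
    (hξ : ξ.origin ∈ e.source) :
    base (fun i => ξ.localEval fun y => e y i) = e ξ.origin := by
  ext i
  obtain ⟨f, hf⟩ := exists_extension e.open_source hξ (contMDiffOn_coord he i)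
  change aug A (ξ.localEval fun y => e y i) = _
  rw [localEval_eq _ hf, aug_eq_of_sub_mem (ξ.sub_origin_mem f), hf.eq_of_nhds]

open Classical in
/-- The chart `ξ ↦ (ξ(x₁), …, ξ(xₙ))` of `M^A` over the chart `(x₁, …, xₙ)` of `M`. -/
def chart (A : Type*) [NormedCommRing A] [NormedAlgebra ℝ A] [IsWeilAlgebra A]
    (e : OpenPartialHomeomorph M (EuclideanSpace ℝ (Fin n)))
    (he : e ∈ atlas (EuclideanSpace ℝ (Fin n)) M) :
    PartialEquiv (WeilBundle n M A) (Fin n → A) where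
  toFun ξ i := ξ.localEval fun y => e y i
  invFun c := if hc : base c ∈ e.target then ofCoord e he c hc else const A (e.symm 0)
  source := {ξ | ξ.origin ∈ e.source}
  target := base ⁻¹' e.target
  map_source' ξ hξ := by
    rw [Set.mem_preimage, base_localEval he hξ]
    exact e.map_source hξ
  map_target' c hc := by
    rw [dif_pos (show base c ∈ e.target from hc), Set.mem_ofPred_eq, origin_ofCoord]
    exact e.map_target hc
  left_inv' ξ hξ := by
    have hb := base_localEval he hξ
    have hc : base (fun i => ξ.localEval fun y => e y i) ∈ e.target := hb ▸ e.map_source hξ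
    rw [dif_pos hc]
    refine ext_of_coord he (x := ξ.origin) ?_ rfl hξ fun i => localEval_ofCoord_self he hc i
    rw [origin_ofCoord, hb, e.left_inv hξ]
  right_inv' c hc := by
    rw [dif_pos (show base c ∈ e.target from hc)]
    exact funext fun i => localEval_ofCoord_self he hc i

theorem chart_symm_apply {e : OpenPartialHomeomorph M (EuclideanSpace ℝ (Fin n))}
    (he : e ∈ atlas (EuclideanSpace ℝ (Fin n)) M) {c : Fin n → A} (hc : base c ∈ e.target) :
    (chart A e he).symm c = ofCoord e he c hc := dif_pos hc

theorem chart_trans_source {e e' : OpenPartialHomeomorph M (EuclideanSpace ℝ (Fin n))}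
    (he : e ∈ atlas (EuclideanSpace ℝ (Fin n)) M) (he' : e' ∈ atlas (EuclideanSpace ℝ (Fin n)) M) :
    ((chart A e he).symm.trans (chart A e' he')).source =
      base ⁻¹' (e.target ∩ e.symm ⁻¹' e'.source) := by
  ext c
  simp only [PartialEquiv.trans_source, PartialEquiv.symm_source, Set.mem_inter_iff,
    Set.mem_preimage]
  refine and_congr_right fun hc => ?_
  change base c ∈ e.target at hc
  rw [chart_symm_apply he hc]
  change (ofCoord e he c hc).origin ∈ e'.source ↔ _
  rw [origin_ofCoord]

theorem contDiffOn_chart_trans {e e' : OpenPartialHomeomorph M (EuclideanSpace ℝ (Fin n))}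
    (he : e ∈ atlas (EuclideanSpace ℝ (Fin n)) M) (he' : e' ∈ atlas (EuclideanSpace ℝ (Fin n)) M) :
    ContDiffOn ℝ ∞ ((chart A e he).symm.trans (chart A e' he'))
      ((chart A e he).symm.trans (chart A e' he')).source := by
  rw [chart_trans_source]
  have h : ContDiffOn ℝ ∞ (fun (c : Fin n → A) i => weilExt (fun y => e' (e.symm y) i) c)
      (base ⁻¹' (e.target ∩ e.symm ⁻¹' e'.source)) :=
    contDiffOn_pi.2 fun i => contDiffOn_weilExt
      (e.isOpen_inter_preimage_symm e'.open_source)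
      (contDiffOn_comp_symm he (contMDiffOn_coord he' i))
  refine h.congr fun c hc => ?_
  rw [PartialEquiv.coe_trans, Function.comp_apply, chart_symm_apply he hc.1]
  exact funext fun i => localEval_ofCoord he he' hc.1 hc.2 i

variable (n M A) in
/-- The atlas of `M^A` made of the charts over the charts of `M`. -/
def core : ChartedSpaceCore (Fin n → A) (WeilBundle n M A) where
  atlas := {P | ∃ e, ∃ he : e ∈ atlas (EuclideanSpace ℝ (Fin n)) M, P = chart A e he}
  chartAt ξ := chart A (chartAt (EuclideanSpace ℝ (Fin n)) ξ.origin) (chart_mem_atlas _ _)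
  mem_chart_source ξ := mem_chart_source (EuclideanSpace ℝ (Fin n)) ξ.origin
  chart_mem_atlas _ := ⟨_, _, rfl⟩
  open_source := by
    rintro _ _ ⟨e, he, rfl⟩ ⟨e', he', rfl⟩
    rw [chart_trans_source]
    exact (e.isOpen_inter_preimage_symm e'.open_source).preimage contDiff_base.continuous
  continuousOn_toFun := by
    rintro _ _ ⟨e, he, rfl⟩ ⟨e', he', rfl⟩
    exact (contDiffOn_chart_trans he he').continuousOn

/-- The topology of the manifold `M^A`, given by its atlas. -/
instance : TopologicalSpace (WeilBundle n M A) := (core n M A).toTopologicalSpace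

/-- The atlas of `M^A`, modelled on `Aⁿ`. -/
instance : ChartedSpace (Fin n → A) (WeilBundle n M A) := (core n M A).toChartedSpace

/-- `M^A` is a smooth manifold. -/
instance : IsManifold 𝓘(ℝ, Fin n → A) ∞ (WeilBundle n M A) := by
  refine isManifold_of_contDiffOn _ _ _ fun P P' hP hP' => ?_
  have key : ∀ P ∈ atlas (Fin n → A) (WeilBundle n M A), ∃ e,
      ∃ he : e ∈ atlas (EuclideanSpace ℝ (Fin n)) M, P.toPartialEquiv = chart A e he := by
    intro P hP
    obtain ⟨_, ⟨Q, rfl⟩, _, ⟨⟨e, he, rfl⟩, rfl⟩, hPQ⟩ := hP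
    refine ⟨e, he, ?_⟩
    rw [Set.mem_singleton_iff.1 hPQ]
    rfl
  obtain ⟨e, he, h⟩ := key P hP
  obtain ⟨e', he', h'⟩ := key P' hP'
  have := contDiffOn_chart_trans (A := A) he he'
  rw [← h, ← h'] at this
  simpa using! this

/-- Addition and multiplication of `A` are smooth, so that `C^∞(M^A, A)` is an algebra. -/
instance contMDiffRing_of_normed (A : Type*) [NormedCommRing A] [NormedAlgebra ℝ A] :
    ContMDiffRing 𝓘(ℝ, A) ∞ A where
  __ := (inferInstance : IsManifold 𝓘(ℝ, A) ∞ A)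
  contMDiff_add := by
    rw [← modelWithCornersSelf_prod, chartedSpaceSelf_prod]
    exact (contDiff_fst.add contDiff_snd).contMDiff
  contMDiff_mul := by
    rw [← modelWithCornersSelf_prod, chartedSpaceSelf_prod]
    exact (contDiff_fst.mul contDiff_snd).contMDiff


variable (n M A) in
/-- `C^∞(M^A, A)`. -/
abbrev Fun : Type _ := C^∞⟮𝓘(ℝ, Fin n → A), WeilBundle n M A; 𝓘(ℝ, A), A⟯

theorem contMDiff_apply (f : SmoothFun n M) :
    ContMDiff 𝓘(ℝ, Fin n → A) 𝓘(ℝ, A) ∞ fun ξ : WeilBundle n M A => ξ.toAlgHom f := by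
  intro ξ
  let e := chartAt (EuclideanSpace ℝ (Fin n)) ξ.origin
  have he : e ∈ atlas (EuclideanSpace ℝ (Fin n)) M := chart_mem_atlas _ _
  let P := chartAt (Fin n → A) ξ
  have h1 : ContMDiffOn 𝓘(ℝ, Fin n → A) 𝓘(ℝ, Fin n → A) ∞ P P.source := contMDiffOn_chart
  have h2 : ContDiffOn ℝ ∞ (weilExt (f ∘ e.symm)) (base ⁻¹' e.target : Set (Fin n → A)) := by
    have := contDiffOn_comp_symm he (f.contMDiff.contMDiffOn (s := Set.univ))
    rw [Set.preimage_univ, Set.inter_univ] at this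
    exact contDiffOn_weilExt e.open_target this
  have h3 := (h2.contMDiffOn.comp h1 fun ζ hζ => P.map_source hζ)
  refine (h3.congr fun ζ hζ => ?_).contMDiffAt (P.open_source.mem_nhds (mem_chart_source _ ξ))
  have h4 : P.symm (P ζ) = ζ := P.left_inv hζ
  have h5 : base (P ζ) ∈ e.target := P.map_source hζ
  have h6 : P.symm (P ζ) = ofCoord e he (P ζ) h5 := chart_symm_apply he h5
  conv_lhs => rw [← h4, h6, ofCoord_apply]
  rfl

variable (A) in
/-- The prolongation `f^A : M^A → A`, `ξ ↦ ξ(f)`, as a linear map `f ↦ f^A`. -/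
def prolong : SmoothFun n M →ₗ[ℝ] Fun n M A where
  toFun f := ⟨fun ξ => ξ.toAlgHom f, contMDiff_apply f⟩
  map_add' f g := by ext ξ; exact map_add ξ.toAlgHom f g
  map_smul' r f := by ext ξ; exact map_smul ξ.toAlgHom r f

/-- The constant function `a` on `M^A`. -/
def constFun (a : A) : Fun n M A := ⟨fun _ => a, contMDiff_const⟩

/-- `φ` belongs to `C^∞(M^A) ⊆ C^∞(M^A, A)`, that is, `φ` takes its values in `ℝ ⊆ A`. -/
def IsReal (φ : Fun n M A) : Prop := ∀ ξ, ∃ r : ℝ, φ ξ = algebraMap ℝ A r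

/-- `D` is the derivation `X̃` of `C^∞(M^A, A)` attached to a vector field
`X : C^∞(M) → C^∞(M^A, A)` on `M^A`: it is `A`-linear, it maps `C^∞(M^A)` to itself, and
`D(f^A) = X(f)`. -/
structure IsLift (X : SmoothFun n M → Fun n M A) (D : Derivation ℝ (Fun n M A) (Fun n M A)) :
    Prop where
  map_constFun_mul : ∀ (a : A) (φ : Fun n M A), D (constFun a * φ) = constFun a * D φ
  isReal : ∀ φ : Fun n M A, IsReal φ → IsReal (D φ)
  apply_prolong : ∀ f : SmoothFun n M, D (prolong A f) = X f

open Classical in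
/-- The derivation `X̃` of `C^∞(M^A, A)` attached to a vector field `X` on `M^A` (which exists and
is unique for every such `X`; the value `0` is used only if there is none). -/
def lift (X : SmoothFun n M → Fun n M A) : Derivation ℝ (Fun n M A) (Fun n M A) :=
  if h : ∃ D, IsLift X D then h.choose else 0

end Charts
end WeilBundle

namespace LieCochain

variable {L V : Type*} [AddCommGroup L] [Module ℝ L] [AddCommGroup V] [Module ℝ V]

/-- The second sum of the Chevalley–Eilenberg differential,
`∑_{i < j} (-1)^(i + j) Ω([f_i, f_j], f_0, …, f̂_i, …, f̂_j, …, f_p)`. -/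
def bracketSum (br : L → L → L) : (p : ℕ) → (L [⋀^Fin p]→ₗ[ℝ] V) → (Fin (p + 1) → L) → V
  | 0, _, _ => 0
  | p + 1, Ω, f => ∑ j : Fin (p + 2), ∑ i : Fin (p + 1),
      if i.castSucc < j then
        (-1 : ℝ) ^ ((i : ℕ) + (j : ℕ)) •
          Ω (Fin.cons (br (f i.castSucc) (f j)) (i.removeNth (j.removeNth f)))
      else 0

/-- The Chevalley–Eilenberg differential of skew-symmetric multilinear `p`-forms on the Lie algebra
`(L, br)` with values in the representation `ρ`,
`(dΩ)(f_0, …, f_p) = ∑ᵢ (-1)^i ρ(f_i)(Ω(f_0, …, f̂_i, …, f_p)) +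
∑_{i < j} (-1)^(i + j) Ω([f_i, f_j], f_0, …, f̂_i, …, f̂_j, …, f_p)` (indices from `0`).
The form `dΩ` is given as a function of `(f_0, …, f_p)`. -/
def d (br : L → L → L) (ρ : L → V →ₗ[ℝ] V) (p : ℕ) :
    (L [⋀^Fin p]→ₗ[ℝ] V) →ₗ[ℝ] ((Fin (p + 1) → L) → V) where
  toFun Ω f := ∑ i : Fin (p + 1), (-1 : ℝ) ^ (i : ℕ) • ρ (f i) (Ω (i.removeNth f)) +
    bracketSum br p Ω f
  map_add' Ω Ω' := by
    have h : ∀ f, bracketSum br p (Ω + Ω') f = bracketSum br p Ω f + bracketSum br p Ω' f := by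
      intro f
      cases p with
      | zero => simp [bracketSum]
      | succ p =>
        simp only [bracketSum, AlternatingMap.add_apply, smul_add, ← Finset.sum_add_distrib]
        refine Finset.sum_congr rfl fun j _ => Finset.sum_congr rfl fun i _ => ?_
        split_ifs <;> simp
    funext f
    simp only [h, AlternatingMap.add_apply, map_add, smul_add, Finset.sum_add_distrib,
      Pi.add_apply]
    abel
  map_smul' c Ω := by
    have h : ∀ f, bracketSum br p (c • Ω) f = c • bracketSum br p Ω f := by
      intro f
      cases p with
      | zero => simp [bracketSum]
      | succ p =>
        simp only [bracketSum, AlternatingMap.smul_apply, Finset.smul_sum]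
        refine Finset.sum_congr rfl fun j _ => Finset.sum_congr rfl fun i _ => ?_
        split_ifs
        · rw [smul_comm]
        · simp
    funext f
    simp only [h, AlternatingMap.smul_apply, map_smul, RingHom.id_apply, Pi.smul_apply, smul_add,
      Finset.smul_sum]
    congr 1
    exact Finset.sum_congr rfl fun i _ => smul_comm _ _ _

/-- Closed `p`-forms. -/
def cocycles (br : L → L → L) (ρ : L → V →ₗ[ℝ] V) (p : ℕ) : Submodule ℝ (L [⋀^Fin p]→ₗ[ℝ] V) :=
  LinearMap.ker (d br ρ p)

/-- Exact `p`-forms: the `p`-forms `dν` with `ν` a `(p - 1)`-form, and `0` for `p = 0`. -/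
def coboundaries (br : L → L → L) (ρ : L → V →ₗ[ℝ] V) :
    (p : ℕ) → Submodule ℝ (L [⋀^Fin p]→ₗ[ℝ] V)
  | 0 => ⊥
  | p + 1 =>
    { carrier := {Ω | ∃ ν : L [⋀^Fin p]→ₗ[ℝ] V, ⇑Ω = d br ρ p ν}
      add_mem' := by
        rintro Ω Ω' ⟨ν, h⟩ ⟨ν', h'⟩
        exact ⟨ν + ν', by rw [map_add, ← h, ← h']; rfl⟩
      zero_mem' := ⟨0, by rw [map_zero]; rfl⟩
      smul_mem' := by
        rintro c Ω ⟨ν, h⟩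
        exact ⟨c • ν, by rw [map_smul, ← h]; rfl⟩ }

/-- The cohomology `Hᵖ = Zᵖ / Bᵖ`. -/
abbrev Cohomology (br : L → L → L) (ρ : L → V →ₗ[ℝ] V) (p : ℕ) : Type _ :=
  cocycles br ρ p ⧸ (coboundaries br ρ p).submoduleOf (cocycles br ρ p)

end LieCochain

/-- A Poisson structure on `M`. -/
structure PoissonStructure (n : ℕ) (M : Type*) [TopologicalSpace M]
    [ChartedSpace (EuclideanSpace ℝ (Fin n)) M] where
  bracket : SmoothFun n M →ₗ[ℝ] SmoothFun n M →ₗ[ℝ] SmoothFun n M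
  bracket_self : ∀ f, bracket f f = 0
  jacobi : ∀ f g h, bracket f (bracket g h) + bracket g (bracket h f) +
    bracket h (bracket f g) = 0
  leibniz : ∀ f g h, bracket f (g * h) = bracket f g * h + g * bracket f h

namespace PoissonStructure

variable {n : ℕ} {M : Type*} [TopologicalSpace M] [ChartedSpace (EuclideanSpace ℝ (Fin n)) M]

/-- `Λ_Pois^p(M)`: skew-symmetric `p`-linear forms from `C^∞(M)` to `C^∞(M)`. -/
abbrev Form (n : ℕ) (M : Type*) [TopologicalSpace M] [ChartedSpace (EuclideanSpace ℝ (Fin n)) M]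
    (p : ℕ) : Type _ := SmoothFun n M [⋀^Fin p]→ₗ[ℝ] SmoothFun n M

/-- The bracket of `C^∞(M)`. -/
abbrev br (P : PoissonStructure n M) (f g : SmoothFun n M) : SmoothFun n M := P.bracket f g

/-- The adjoint representation `f ↦ {f, ·}` of `C^∞(M)`. -/
abbrev ad (P : PoissonStructure n M) (f : SmoothFun n M) : SmoothFun n M →ₗ[ℝ] SmoothFun n M :=
  P.bracket f

/-- The Poisson cohomology operator `d` of `M`. -/
abbrev d (P : PoissonStructure n M) (p : ℕ) :
    Form n M p →ₗ[ℝ] ((Fin (p + 1) → SmoothFun n M) → SmoothFun n M) :=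
  LieCochain.d P.br P.ad p

variable [T2Space M] [IsManifold (𝓡 n) ∞ M]

/-- `Λ_Pois^p(M^A, ∼)`: skew-symmetric `p`-linear forms from `C^∞(M)` to `C^∞(M^A, A)`. -/
abbrev WeilForm (n : ℕ) (M : Type*) [TopologicalSpace M]
    [ChartedSpace (EuclideanSpace ℝ (Fin n)) M] [T2Space M] [IsManifold (𝓡 n) ∞ M] (A : Type*)
    [NormedCommRing A] [NormedAlgebra ℝ A] [IsWeilAlgebra A] (p : ℕ) : Type _ :=
  SmoothFun n M [⋀^Fin p]→ₗ[ℝ] WeilBundle.Fun n M A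

variable (A : Type*) [NormedCommRing A] [NormedAlgebra ℝ A] [IsWeilAlgebra A]

/-- The prolongation `[ad(f)]^A : g ↦ {f, g}^A` of the vector field `ad(f)`. -/
def adProlong (P : PoissonStructure n M) (f g : SmoothFun n M) : WeilBundle.Fun n M A :=
  WeilBundle.prolong A (P.ad f g)

/-- The representation `f ↦ \widetilde{[ad(f)]^A}` of `C^∞(M)` on `C^∞(M^A, A)`. -/
def adTilde (P : PoissonStructure n M) (f : SmoothFun n M) :
    WeilBundle.Fun n M A →ₗ[ℝ] WeilBundle.Fun n M A :=
  (WeilBundle.lift (P.adProlong A f)).toLinearMap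

/-- The cohomology operator `d̃` of that representation. -/
abbrev dTilde (P : PoissonStructure n M) (p : ℕ) :
    WeilForm n M A p →ₗ[ℝ] ((Fin (p + 1) → SmoothFun n M) → WeilBundle.Fun n M A) :=
  LieCochain.d P.br (P.adTilde A) p

/-- The prolongation `η^A : (f₁, …, f_p) ↦ [η(f₁, …, f_p)]^A` of a `p`-form `η`. -/
def prolongForm {p : ℕ} (η : Form n M p) : WeilForm n M A p :=
  (WeilBundle.prolong A).compAlternatingMap η

end PoissonStructure

end

/-!
The prolongation `η ↦ η^A` is a morphism of cochain complexes, `d̃(η^A) = (dη)^A`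
(`PoissonStructure.dTilde_prolongForm`), and the three claims follow formally. Comparing the two
Chevalley–Eilenberg formulas term by term, this reduces to `\widetilde{[ad(f)]^A}(g^A) = {f, g}^A`,
which holds by definition once the lift of the vector field `g ↦ {f, g}^A` to a derivation of
`C^∞(M^A, A)` is known to exist.

The existence is proved for every vector field on `M^A` in the algebraic sense, a linear map
`X : C^∞(M) → C^∞(M^A, A)` with `X(fg) = f^A X(g) + g^A X(f)` (`WeilBundle.exists_isLift`). In the
chart of `M^A` over a chart `(x₁, …, xₙ)` of `M`, give `X` at `ξ` the components `X(xᵢ)(ξ) ∈ A`, the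
coordinates `xᵢ` being extended to smooth functions on `M`, and let `X̃ φ` be the directional
derivative of `φ`. The point is that `X̃(g^A) = X(g)`
(`WeilBundle.fderiv_prolong_comp_chartAt_symm`): at `ξ`, both sides are derivations
`T : C^∞(M) → A` along `ξ` as functions of `g`, and they agree on the coordinates. Such a derivation
is the same as a point `ξ + εT` of `M^{A[ε]}` over `ξ`, where the algebra `A[ε]` of dual numbers is
again a Weil algebra, and near points are determined by their coordinates. Applied to the
coordinates of a second chart, whose prolongations are the coordinates of `M^A`, the same formula
and the chain rule give independence of the chart, hence smoothness of `X̃ φ`.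
-/

/-! ### Dual numbers over a Weil algebra -/

open TrivSqZeroExt in
/-- If `A` is a Weil algebra, so is the algebra `A[ε]` of dual numbers over it; its maximal ideal is
`𝔪 ⊕ εA`. -/
instance IsWeilAlgebra.dualNumber {A : Type*} [CommRing A] [Algebra ℝ A] [IsWeilAlgebra A] :
    IsWeilAlgebra (DualNumber A) := by
  have hloc : IsLocalRing (DualNumber A) :=
    IsLocalRing.of_nonunits_add fun a b ha hb => by
      simp only [mem_nonunits_iff, isUnit_iff_isUnit_fst, fst_add] at *
      exact IsLocalRing.nonunits_add ha hb
  have hfin : FiniteDimensional ℝ A := IsWeilAlgebra.finiteDimensional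
  refine { hloc with
    finiteDimensional := inferInstanceAs (Module.Finite ℝ (A × A))
    codim_eq_one := ?_ }
  refine (finrank_eq_one_iff_of_nonzero' (1 : DualNumber A ⧸ _) one_ne_zero).2 fun q => ?_
  obtain ⟨a, rfl⟩ := Ideal.Quotient.mk_surjective q
  obtain ⟨r, hr⟩ := WeilAlgebra.exists_sub_mem a.fst
  refine ⟨r, ?_⟩
  rw [← map_one (Ideal.Quotient.mk (IsLocalRing.maximalIdeal (DualNumber A))), Algebra.smul_def,
    IsScalarTower.algebraMap_apply ℝ (DualNumber A), Ideal.Quotient.algebraMap_eq, ← map_mul,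
    mul_one, eq_comm, Ideal.Quotient.mk_eq_mk_iff_sub_mem, IsLocalRing.mem_maximalIdeal,
    mem_nonunits_iff, isUnit_iff_isUnit_fst]
  exact (IsLocalRing.mem_maximalIdeal _).1 hr

noncomputable section

namespace WeilBundle
open WeilAlgebra

/-! ### Derivations along a near point -/

section Derivation
variable {n : ℕ} {M : Type*} [TopologicalSpace M] [ChartedSpace (EuclideanSpace ℝ (Fin n)) M]
  {A : Type*} [CommRing A] [Algebra ℝ A] [IsWeilAlgebra A]

theorem inl_add_inr_sub_mem (ξ : WeilBundle n M A) (f : SmoothFun n M) (a : A) :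
    TrivSqZeroExt.inl (ξ.toAlgHom f) + TrivSqZeroExt.inr a -
      algebraMap ℝ (DualNumber A) (f ξ.origin) ∈ IsLocalRing.maximalIdeal (DualNumber A) := by
  rw [IsLocalRing.mem_maximalIdeal, mem_nonunits_iff, TrivSqZeroExt.isUnit_iff_isUnit_fst]
  simpa [TrivSqZeroExt.algebraMap_eq_inl'] using
    (IsLocalRing.mem_maximalIdeal _).1 (ξ.sub_origin_mem f)

/-- The point `f ↦ ξ(f) + ε T(f)` of `M^{A[ε]}` given by a derivation `T` along the near point
`ξ`. -/
def dualPoint (ξ : WeilBundle n M A) (T : SmoothFun n M →ₗ[ℝ] A)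
    (hT : ∀ f g, T (f * g) = ξ.toAlgHom f * T g + ξ.toAlgHom g * T f) :
    WeilBundle n M (DualNumber A) where
  toAlgHom := AlgHom.ofLinearMap
    { toFun := fun f => TrivSqZeroExt.inl (ξ.toAlgHom f) + TrivSqZeroExt.inr (T f)
      map_add' := fun f g => by ext <;> simp
      map_smul' := fun r f => by ext <;> simp }
    (by
      have h1 : T 1 = 0 := by simpa using hT 1 1
      ext <;> simp [h1])
    (fun f g => by ext <;> simp [hT, mul_comm])
  exists_origin := ⟨ξ.origin, fun f => ξ.inl_add_inr_sub_mem f (T f)⟩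

variable [T2Space M] [IsManifold (𝓡 n) ∞ M]

/-- A derivation along a near point `ξ` is determined by its values on functions `X₁, …, Xₙ` that
are coordinates near the origin of `ξ`, since the point `ξ + εT` of `M^{A[ε]}` is determined
by its coordinates. -/
theorem derivation_ext_of_coord {e : OpenPartialHomeomorph M (EuclideanSpace ℝ (Fin n))}
    (he : e ∈ atlas (EuclideanSpace ℝ (Fin n)) M) {ξ : WeilBundle n M A}
    (hs : ξ.origin ∈ e.source) {X : Fin n → SmoothFun n M}
    (hX : ∀ i, X i =ᶠ[𝓝 ξ.origin] fun y => e y i) {T T' : SmoothFun n M →ₗ[ℝ] A}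
    (hT : ∀ f g, T (f * g) = ξ.toAlgHom f * T g + ξ.toAlgHom g * T f)
    (hT' : ∀ f g, T' (f * g) = ξ.toAlgHom f * T' g + ξ.toAlgHom g * T' f)
    (h : ∀ i, T (X i) = T' (X i)) : T = T' := by
  have ho : ∀ (S : SmoothFun n M →ₗ[ℝ] A) (hS), (dualPoint ξ S hS).origin = ξ.origin :=
    fun S hS => origin_eq fun f => ξ.inl_add_inr_sub_mem f (S f)
  have key : dualPoint ξ T hT = dualPoint ξ T' hT' := by
    refine ext_of_coord he (ho T hT) (ho T' hT') hs fun i => ?_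
    rw [localEval_eq (f := X i) _ (by rw [ho]; exact hX i),
      localEval_eq (f := X i) _ (by rw [ho]; exact hX i)]
    simp [dualPoint, h]
  ext f
  have := congrArg (fun ζ => (ζ.toAlgHom f).snd) key
  simpa [dualPoint] using this

end Derivation

/-! ### Lifts of vector fields on the Weil bundle -/

section VectorField
variable {n : ℕ} {M : Type*} [TopologicalSpace M] [ChartedSpace (EuclideanSpace ℝ (Fin n)) M]
  [T2Space M] [IsManifold (𝓡 n) ∞ M]
  {A : Type*} [NormedCommRing A] [NormedAlgebra ℝ A] [IsWeilAlgebra A]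

theorem continuous_origin : Continuous (origin : WeilBundle n M A → M) := by
  refine continuous_iff_continuousAt.2 fun ξ₀ => ?_
  let e := chartAt (EuclideanSpace ℝ (Fin n)) ξ₀.origin
  let P := chartAt (Fin n → A) ξ₀
  have he : e ∈ atlas (EuclideanSpace ℝ (Fin n)) M := chart_mem_atlas _ _
  have hs : ξ₀.origin ∈ e.source := mem_chart_source _ _
  have hb : ∀ ξ ∈ P.source, base (P ξ) = e ξ.origin := fun ξ hξ => base_localEval he hξ
  have hP : ContinuousAt P ξ₀ := P.continuousAt (mem_chart_source _ ξ₀)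
  have h1 : ContinuousAt (fun ξ => e.symm (base (P ξ))) ξ₀ := by
    refine ContinuousAt.comp (g := e.symm) ?_ (contDiff_base.continuous.continuousAt.comp hP)
    rw [hb ξ₀ (mem_chart_source _ ξ₀)]
    exact e.continuousAt_symm (e.map_source hs)
  refine h1.congr ?_
  filter_upwards [P.open_source.mem_nhds (mem_chart_source _ ξ₀)] with ξ hξ
  rw [hb ξ hξ, e.left_inv hξ]

/-- If the smooth function `f` on `M` agrees with the `i`-th coordinate near the origin of `ξ`, then
`f^A` agrees with the `i`-th coordinate of `M^A` near `ξ`. -/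
theorem prolong_eventuallyEq_coord {ξ₀ ξ : WeilBundle n M A} {i : Fin n} {f : SmoothFun n M}
    (hf : f =ᶠ[𝓝 ξ.origin] fun y => chartAt (EuclideanSpace ℝ (Fin n)) ξ₀.origin y i) :
    prolong A f =ᶠ[𝓝 ξ] fun ζ => chartAt (Fin n → A) ξ₀ ζ i := by
  filter_upwards [continuous_origin.continuousAt.eventually hf.eventually_nhds] with ζ hζ
  exact (localEval_eq ζ hζ).symm

/-- The coordinate expression of a smooth function on `M^A` is smooth. -/
theorem contDiffAt_comp_chartAt_symm {ξ₀ ξ : WeilBundle n M A}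
    (hξ : ξ ∈ (chartAt (Fin n → A) ξ₀).source) (φ : Fun n M A) :
    ContDiffAt ℝ ∞ (φ ∘ (chartAt (Fin n → A) ξ₀).symm) (chartAt (Fin n → A) ξ₀ ξ) := by
  have h1 : ContMDiffOn 𝓘(ℝ, Fin n → A) 𝓘(ℝ, A) ∞ (φ ∘ (chartAt (Fin n → A) ξ₀).symm)
      (chartAt (Fin n → A) ξ₀).target :=
    φ.contMDiff.comp_contMDiffOn contMDiffOn_chart_symm
  exact h1.contDiffOn.contDiffAt
    ((chartAt (Fin n → A) ξ₀).open_target.mem_nhds ((chartAt (Fin n → A) ξ₀).map_source hξ))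

theorem differentiableAt_comp_chartAt_symm {ξ₀ ξ : WeilBundle n M A}
    (hξ : ξ ∈ (chartAt (Fin n → A) ξ₀).source) (φ : Fun n M A) :
    DifferentiableAt ℝ (φ ∘ (chartAt (Fin n → A) ξ₀).symm) (chartAt (Fin n → A) ξ₀ ξ) :=
  (contDiffAt_comp_chartAt_symm hξ φ).differentiableAt (by simp)

/-- The derivative of the coordinate expression of a product. -/
theorem fderiv_mul_comp_chartAt_symm {ξ₀ ξ : WeilBundle n M A}
    (hξ : ξ ∈ (chartAt (Fin n → A) ξ₀).source) (φ ψ : Fun n M A) (v : Fin n → A) :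
    fderiv ℝ (⇑(φ * ψ) ∘ (chartAt (Fin n → A) ξ₀).symm) (chartAt (Fin n → A) ξ₀ ξ) v =
      φ ξ * fderiv ℝ (ψ ∘ (chartAt (Fin n → A) ξ₀).symm) (chartAt (Fin n → A) ξ₀ ξ) v +
      ψ ξ * fderiv ℝ (φ ∘ (chartAt (Fin n → A) ξ₀).symm) (chartAt (Fin n → A) ξ₀ ξ) v := by
  have h := fderiv_mul (differentiableAt_comp_chartAt_symm hξ φ)
    (differentiableAt_comp_chartAt_symm hξ ψ)
  have hmul : ⇑(φ * ψ) ∘ (chartAt (Fin n → A) ξ₀).symm =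
    (φ ∘ (chartAt (Fin n → A) ξ₀).symm) * (ψ ∘ (chartAt (Fin n → A) ξ₀).symm) := rfl
  rw [hmul, h]
  simp [(chartAt (Fin n → A) ξ₀).left_inv hξ]

theorem fderiv_add_comp_chartAt_symm {ξ₀ ξ : WeilBundle n M A}
    (hξ : ξ ∈ (chartAt (Fin n → A) ξ₀).source) (φ ψ : Fun n M A) (v : Fin n → A) :
    fderiv ℝ (⇑(φ + ψ) ∘ (chartAt (Fin n → A) ξ₀).symm) (chartAt (Fin n → A) ξ₀ ξ) v =
      fderiv ℝ (φ ∘ (chartAt (Fin n → A) ξ₀).symm) (chartAt (Fin n → A) ξ₀ ξ) v +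
      fderiv ℝ (ψ ∘ (chartAt (Fin n → A) ξ₀).symm) (chartAt (Fin n → A) ξ₀ ξ) v := by
  have h := fderiv_add (differentiableAt_comp_chartAt_symm hξ φ)
    (differentiableAt_comp_chartAt_symm hξ ψ)
  exact congrArg (fun L => L v) h

theorem fderiv_smul_comp_chartAt_symm {ξ₀ ξ : WeilBundle n M A}
    (hξ : ξ ∈ (chartAt (Fin n → A) ξ₀).source) (r : ℝ) (φ : Fun n M A) (v : Fin n → A) :
    fderiv ℝ (⇑(r • φ) ∘ (chartAt (Fin n → A) ξ₀).symm) (chartAt (Fin n → A) ξ₀ ξ) v =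
      r • fderiv ℝ (φ ∘ (chartAt (Fin n → A) ξ₀).symm) (chartAt (Fin n → A) ξ₀ ξ) v := by
  have h := fderiv_const_smul (differentiableAt_comp_chartAt_symm hξ φ) r
  exact congrArg (fun L => L v) h

theorem exists_coord_extension (x : M) :
    ∃ f : Fin n → SmoothFun n M,
      ∀ i, f i =ᶠ[𝓝 x] fun y => chartAt (EuclideanSpace ℝ (Fin n)) x y i := by
  choose f hf using fun i : Fin n =>
    exists_extension (chartAt (EuclideanSpace ℝ (Fin n)) x).open_source (mem_chart_source _ x)
      (contMDiffOn_coord (chart_mem_atlas (EuclideanSpace ℝ (Fin n)) x) i)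
  exact ⟨f, hf⟩

/-- The functions `f₁, …, fₙ ∈ C^∞(M)` that agree near `x` with the coordinates of the preferred
chart at `x`. -/
def coordFun (x : M) : Fin n → SmoothFun n M := (exists_coord_extension (n := n) x).choose

theorem coordFun_eventuallyEq (x : M) (i : Fin n) :
    coordFun x i =ᶠ[𝓝 x] fun y => chartAt (EuclideanSpace ℝ (Fin n)) x y i :=
  (exists_coord_extension (n := n) x).choose_spec i

/-- The derivative of `φ` at `ξ` along the vector field `X`, computed in the preferred chart of
`M^A` at `ξ`. -/
def dirDeriv (X : SmoothFun n M →ₗ[ℝ] Fun n M A) (φ : Fun n M A) (ξ : WeilBundle n M A) : A :=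
  fderiv ℝ (φ ∘ (chartAt (Fin n → A) ξ).symm) (chartAt (Fin n → A) ξ ξ)
    fun i => X (coordFun ξ.origin i) ξ

variable {X : SmoothFun n M →ₗ[ℝ] Fun n M A}
  (hX : ∀ f g, X (f * g) = prolong A f * X g + prolong A g * X f)
include hX

/-- A vector field `X : C^∞(M) → C^∞(M^A, A)` has at `ξ`, in the chart of `M^A` over the chart
`(x₁, …, xₙ)` of `M`, the components `X(xᵢ)(ξ)`: both sides are derivations along `ξ`, as functions
of `g`, and they agree on the coordinates. -/
theorem fderiv_prolong_comp_chartAt_symm {ξ₀ ξ : WeilBundle n M A}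
    (hξ : ξ ∈ (chartAt (Fin n → A) ξ₀).source) {x : Fin n → SmoothFun n M}
    (hx : ∀ i, x i =ᶠ[𝓝 ξ.origin] fun y => chartAt (EuclideanSpace ℝ (Fin n)) ξ₀.origin y i)
    (g : SmoothFun n M) :
    fderiv ℝ (prolong A g ∘ (chartAt (Fin n → A) ξ₀).symm) (chartAt (Fin n → A) ξ₀ ξ)
      (fun i => X (x i) ξ) = X g ξ := by
  set P := chartAt (Fin n → A) ξ₀
  have hmul : ∀ f g : SmoothFun n M, prolong A (f * g) = prolong A f * prolong A g :=
    fun f g => by ext ζ; exact map_mul ζ.toAlgHom f g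
  let T : SmoothFun n M →ₗ[ℝ] A :=
    { toFun := fun g => fderiv ℝ (prolong A g ∘ P.symm) (P ξ) fun i => X (x i) ξ
      map_add' := fun f g => by
        rw [map_add]
        exact fderiv_add_comp_chartAt_symm hξ _ _ _
      map_smul' := fun r f => by
        rw [map_smul]
        exact fderiv_smul_comp_chartAt_symm hξ _ _ _ }
  let T' : SmoothFun n M →ₗ[ℝ] A :=
    { toFun := fun g => X g ξ
      map_add' := fun f g => by rw [map_add]; rfl
      map_smul' := fun r f => by rw [map_smul]; rfl }
  have key : T = T' := by
    refine derivation_ext_of_coord (ξ := ξ) (chart_mem_atlas _ ξ₀.origin) hξ hx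
      (fun f g => ?_) (fun f g => ?_) fun i => ?_
    · change fderiv ℝ (prolong A (f * g) ∘ P.symm) (P ξ) _ = _
      rw [hmul, fderiv_mul_comp_chartAt_symm hξ]
      rfl
    · change X (f * g) ξ = _
      rw [hX]
      rfl
    · have h1 : prolong A (x i) ∘ P.symm =ᶠ[𝓝 (P ξ)] fun c => c i := by
        have h2 := P.continuousAt_symm (P.map_source hξ)
        rw [ContinuousAt, P.left_inv hξ] at h2
        filter_upwards [h2.eventually (prolong_eventuallyEq_coord (hx i)),
          P.open_target.mem_nhds (P.map_source hξ)] with c hc hc'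
        rw [Function.comp_apply, hc, P.right_inv hc']
      change fderiv ℝ (prolong A (x i) ∘ P.symm) (P ξ) _ = X (x i) ξ
      rw [h1.fderiv_eq, (hasFDerivAt_apply i (P ξ)).fderiv]
      rfl
  exact congrArg (fun S => S g) key

/-- The directional derivative along a vector field `X : C^∞(M) → C^∞(M^A, A)` does not depend on
the chart. -/
theorem fderiv_comp_chartAt_symm_congr {ξ₀ ξ₁ ξ : WeilBundle n M A}
    (hξ₀ : ξ ∈ (chartAt (Fin n → A) ξ₀).source) (hξ₁ : ξ ∈ (chartAt (Fin n → A) ξ₁).source)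
    {x x' : Fin n → SmoothFun n M}
    (hx : ∀ i, x i =ᶠ[𝓝 ξ.origin] fun y => chartAt (EuclideanSpace ℝ (Fin n)) ξ₀.origin y i)
    (hx' : ∀ i, x' i =ᶠ[𝓝 ξ.origin] fun y => chartAt (EuclideanSpace ℝ (Fin n)) ξ₁.origin y i)
    (φ : Fun n M A) :
    fderiv ℝ (φ ∘ (chartAt (Fin n → A) ξ₀).symm) (chartAt (Fin n → A) ξ₀ ξ)
        (fun i => X (x i) ξ) =
      fderiv ℝ (φ ∘ (chartAt (Fin n → A) ξ₁).symm) (chartAt (Fin n → A) ξ₁ ξ)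
        (fun i => X (x' i) ξ) := by
  set P := chartAt (Fin n → A) ξ₀
  set Q := chartAt (Fin n → A) ξ₁
  have h0 := P.continuousAt_symm (P.map_source hξ₀)
  rw [ContinuousAt, P.left_inv hξ₀] at h0
  -- Near `P ξ` the transition map `Q ∘ P⁻¹` has the components `(x'ᵢ)^A ∘ P⁻¹`.
  have h1 : HasFDerivAt (fun c i => prolong A (x' i) (P.symm c))
      (ContinuousLinearMap.pi fun i => fderiv ℝ (prolong A (x' i) ∘ P.symm) (P ξ)) (P ξ) :=
    hasFDerivAt_pi.2 fun i => (differentiableAt_comp_chartAt_symm hξ₀ _).hasFDerivAt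
  have h2 : (fun i => prolong A (x' i) (P.symm (P ξ))) = Q ξ := by
    funext i
    rw [P.left_inv hξ₀]
    exact (prolong_eventuallyEq_coord (hx' i)).eq_of_nhds
  have h3 : HasFDerivAt (φ ∘ Q.symm) (fderiv ℝ (φ ∘ Q.symm) (Q ξ))
      ((fun c i => prolong A (x' i) (P.symm c)) (P ξ)) := by
    change HasFDerivAt _ _ (fun i => prolong A (x' i) (P.symm (P ξ)))
    rw [h2]
    exact (differentiableAt_comp_chartAt_symm hξ₁ φ).hasFDerivAt
  have h4 : φ ∘ P.symm =ᶠ[𝓝 (P ξ)]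
      (φ ∘ Q.symm) ∘ fun c i => prolong A (x' i) (P.symm c) := by
    filter_upwards [h0.eventually (Filter.eventually_all.2 fun i =>
      prolong_eventuallyEq_coord (hx' i)), h0.eventually (Q.open_source.mem_nhds hξ₁)] with c hc hc'
    have h5 : (fun i => prolong A (x' i) (P.symm c)) = Q (P.symm c) := funext hc
    rw [Function.comp_apply, Function.comp_apply, Function.comp_apply, h5, Q.left_inv hc']
  rw [((h3.comp (P ξ) h1).congr_of_eventuallyEq h4).fderiv, ContinuousLinearMap.comp_apply]
  congr 1
  funext i
  exact fderiv_prolong_comp_chartAt_symm hX hξ₀ hx (x' i)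

theorem contMDiff_dirDeriv (φ : Fun n M A) :
    ContMDiff 𝓘(ℝ, Fin n → A) 𝓘(ℝ, A) ∞ (dirDeriv X φ) := by
  intro ξ₀
  let P := chartAt (Fin n → A) ξ₀
  have hξ₀ : ξ₀ ∈ P.source := mem_chart_source _ ξ₀
  have h1 : dirDeriv X φ =ᶠ[𝓝 ξ₀] fun ξ => fderiv ℝ (φ ∘ P.symm) (P ξ)
      fun i => X (coordFun ξ₀.origin i) ξ := by
    filter_upwards [P.open_source.mem_nhds hξ₀, continuous_origin.continuousAt.eventually
      (Filter.eventually_all.2 fun i : Fin n =>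
        (coordFun_eventuallyEq ξ₀.origin i).eventually_nhds)] with ξ hξ hξ'
    exact fderiv_comp_chartAt_symm_congr hX (mem_chart_source _ ξ) hξ
      (coordFun_eventuallyEq ξ.origin) hξ' φ
  refine ContMDiffAt.congr_of_eventuallyEq ?_ h1
  have h2 : ContMDiffAt 𝓘(ℝ, Fin n → A) 𝓘(ℝ, Fin n → A) ∞ P ξ₀ :=
    contMDiffOn_chart.contMDiffAt (P.open_source.mem_nhds hξ₀)
  have h3 : ContDiffAt ℝ ∞ (fderiv ℝ (φ ∘ P.symm)) (P ξ₀) :=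
    (contDiffAt_comp_chartAt_symm hξ₀ φ).fderiv_right (by simp)
  have h4 : ContMDiffAt 𝓘(ℝ, Fin n → A) 𝓘(ℝ, Fin n → A) ∞
      (fun ξ i => X (coordFun ξ₀.origin i) ξ) ξ₀ :=
    contMDiffAt_pi_space.2 fun i => (X (coordFun ξ₀.origin i)).contMDiff.contMDiffAt
  exact (ContMDiffAt.comp ξ₀ h3.contMDiffAt h2).clm_apply h4

/-- Every vector field `X : C^∞(M) → C^∞(M^A, A)` extends to an `A`-linear derivation of
`C^∞(M^A, A)` that preserves `C^∞(M^A)`, namely the directional derivative along `X`. -/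
theorem exists_isLift : ∃ D : Derivation ℝ (Fun n M A) (Fun n M A), IsLift X D := by
  let L : Fun n M A →ₗ[ℝ] Fun n M A :=
    { toFun := fun φ => ⟨dirDeriv X φ, contMDiff_dirDeriv hX φ⟩
      map_add' := fun φ ψ => by
        ext ξ
        exact fderiv_add_comp_chartAt_symm (mem_chart_source _ ξ) φ ψ _
      map_smul' := fun r φ => by
        ext ξ
        exact fderiv_smul_comp_chartAt_symm (mem_chart_source _ ξ) r φ _ }
  have hL : ∀ φ ψ, L (φ * ψ) = φ • L ψ + ψ • L φ := fun φ ψ => by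
    ext ξ
    exact fderiv_mul_comp_chartAt_symm (mem_chart_source _ ξ) φ ψ _
  refine ⟨Derivation.mk' L hL, fun a φ => ?_, fun φ hφ ξ => ?_, fun f => ?_⟩
  · have h0 : L (constFun a) = 0 := by
      ext ξ
      change fderiv ℝ (fun _ => a) _ _ = 0
      simp
    change L _ = constFun a * L φ
    rw [hL, h0, smul_zero, add_zero, smul_eq_mul]
  · -- A real-valued `φ` is the composite of the linear maps `A → ℝ → A` with `φ`.
    have : FiniteDimensional ℝ A := IsWeilAlgebra.finiteDimensional
    let p : A →L[ℝ] ℝ := LinearMap.toContinuousLinearMap (aug A).toLinearMap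
    set P := chartAt (Fin n → A) ξ
    have hd : DifferentiableAt ℝ (φ ∘ P.symm) (P ξ) :=
      differentiableAt_comp_chartAt_symm (mem_chart_source _ ξ) φ
    have h1 : φ ∘ P.symm = fun c => ((algebraMapCLM ℝ A).comp p) ((φ ∘ P.symm) c) := by
      funext c
      obtain ⟨r, hr⟩ := hφ (P.symm c)
      have h2 : aug A (algebraMap ℝ A r) = r := (aug A).commutes r
      change φ (P.symm c) = algebraMap ℝ A (aug A (φ (P.symm c)))
      rw [hr, h2]
    have h2 := (((algebraMapCLM ℝ A).comp p).hasFDerivAt.comp (P ξ) hd.hasFDerivAt).fderiv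
    refine ⟨p (fderiv ℝ (φ ∘ P.symm) (P ξ) fun i => X (coordFun ξ.origin i) ξ), ?_⟩
    change fderiv ℝ (φ ∘ P.symm) (P ξ) _ = _
    have h3 : fderiv ℝ (φ ∘ P.symm) (P ξ) =
      ((algebraMapCLM ℝ A).comp p).comp (fderiv ℝ (φ ∘ P.symm) (P ξ)) :=
        (congrArg (fun F => fderiv ℝ F (P ξ)) h1).trans h2
    exact congrArg (fun S => S fun i => X (coordFun ξ.origin i) ξ) h3
  · ext ξ
    exact fderiv_prolong_comp_chartAt_symm hX (mem_chart_source _ ξ)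
      (coordFun_eventuallyEq ξ.origin) f

theorem isLift_lift : IsLift X (lift X) := by
  rw [lift, dif_pos (exists_isLift hX)]
  exact (exists_isLift hX).choose_spec

end VectorField
end WeilBundle

/-! ### Prolongation of forms and of cohomology classes -/

namespace PoissonStructure
open WeilBundle
variable {n : ℕ} {M : Type*} [TopologicalSpace M] [ChartedSpace (EuclideanSpace ℝ (Fin n)) M]
  [T2Space M] [IsManifold (𝓡 n) ∞ M]
  (A : Type*) [NormedCommRing A] [NormedAlgebra ℝ A] [IsWeilAlgebra A]

theorem adTilde_prolong (P : PoissonStructure n M) (f g : SmoothFun n M) :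
    P.adTilde A f (prolong A g) = prolong A (P.ad f g) := by
  have h := isLift_lift (X := (prolong A).comp (P.ad f)) fun g h => by
    ext ξ
    change ξ.toAlgHom (P.bracket f (g * h)) = ξ.toAlgHom g * ξ.toAlgHom (P.bracket f h) +
      ξ.toAlgHom h * ξ.toAlgHom (P.bracket f g)
    rw [P.leibniz, map_add, map_mul, map_mul]
    ring
  exact h.apply_prolong g

/-- Prolongation is a morphism of cochain complexes: `d̃(η^A) = (dη)^A`. -/
theorem dTilde_prolongForm (P : PoissonStructure n M) {p : ℕ} (η : Form n M p)
    (f : Fin (p + 1) → SmoothFun n M) :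
    P.dTilde A p (prolongForm A η) f = prolong A (P.d p η f) := by
  have h : LieCochain.bracketSum P.br p (prolongForm A η) f =
      prolong A (LieCochain.bracketSum P.br p η f) := by
    cases p with
    | zero => simp [LieCochain.bracketSum]
    | succ p =>
      simp only [LieCochain.bracketSum, map_sum]
      refine Finset.sum_congr rfl fun j _ => Finset.sum_congr rfl fun i _ => ?_
      split_ifs
      · rw [map_smul]
        rfl
      · rw [map_zero]
  change ∑ i : Fin (p + 1), (-1 : ℝ) ^ (i : ℕ) • P.adTilde A (f i) (prolong A (η (i.removeNth f))) +
    LieCochain.bracketSum P.br p (prolongForm A η) f = prolong A (∑ i : Fin (p + 1),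
      (-1 : ℝ) ^ (i : ℕ) • P.ad (f i) (η (i.removeNth f)) + LieCochain.bracketSum P.br p η f)
  rw [h, map_add, map_sum]
  simp only [adTilde_prolong, map_smul]

theorem prolongForm_mem_cocycles (P : PoissonStructure n M) {p : ℕ} {η : Form n M p}
    (hη : η ∈ LieCochain.cocycles P.br P.ad p) :
    prolongForm A η ∈ LieCochain.cocycles P.br (P.adTilde A) p := by
  refine LinearMap.mem_ker.2 (funext fun f => ?_)
  rw [dTilde_prolongForm]
  exact (congrArg (prolong A) (congrFun (LinearMap.mem_ker.1 hη) f)).trans (map_zero _)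

theorem prolongForm_sub_eq_dTilde (P : PoissonStructure n M) {p : ℕ} {η η' : Form n M (p + 1)}
    {ν : Form n M p} (h : ⇑(η - η') = P.d p ν) :
    ⇑(prolongForm A η - prolongForm A η') = P.dTilde A p (prolongForm A ν) := by
  funext f
  rw [dTilde_prolongForm, ← h]
  exact (map_sub (prolong A) (η f) (η' f)).symm

theorem prolongForm_mem_coboundaries (P : PoissonStructure n M) {p : ℕ} {η : Form n M p}
    (hη : η ∈ LieCochain.coboundaries P.br P.ad p) :
    prolongForm A η ∈ LieCochain.coboundaries P.br (P.adTilde A) p := by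
  cases p with
  | zero =>
    rw [(Submodule.mem_bot ℝ).1 hη]
    exact (Submodule.mem_bot ℝ).2 (by ext f : 1; exact map_zero (prolong A))
  | succ p =>
    obtain ⟨ν, hν⟩ := hη
    refine ⟨prolongForm A ν, funext fun f => ?_⟩
    rw [dTilde_prolongForm, ← hν]
    rfl

/-- The linear map `η ↦ η^A` from the closed forms of `M` to those of `M^A`. -/
def prolongCocycle (P : PoissonStructure n M) (p : ℕ) :
    LieCochain.cocycles P.br P.ad p →ₗ[ℝ] LieCochain.cocycles P.br (P.adTilde A) p where
  toFun η := ⟨prolongForm A η.1, P.prolongForm_mem_cocycles A η.2⟩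
  map_add' η η' := by ext f : 2; exact map_add (prolong A) _ _
  map_smul' r η := by ext f : 2; exact map_smul (prolong A) _ _

end PoissonStructure
end

theorem mainTheorem4 {n : ℕ} {M : Type*} [TopologicalSpace M]
    [ChartedSpace (EuclideanSpace ℝ (Fin n)) M] [IsManifold (𝓡 n) ∞ M] [T2Space M]
    [ParacompactSpace M] {A : Type*} [NormedCommRing A] [NormedAlgebra ℝ A] [IsWeilAlgebra A]
    (P : PoissonStructure n M) :
    (∀ (p : ℕ) (η : PoissonStructure.Form n M p), P.d p η = 0 →
      P.dTilde A p (PoissonStructure.prolongForm A η) = 0) ∧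
    (∀ (p : ℕ) (η η' : PoissonStructure.Form n M (p + 1)) (ν : PoissonStructure.Form n M p),
      ⇑(η - η') = P.d p ν →
      ⇑(PoissonStructure.prolongForm A η - PoissonStructure.prolongForm A η') =
        P.dTilde A p (PoissonStructure.prolongForm A ν)) ∧
    (∀ p : ℕ, ∃! Φ : LieCochain.Cohomology P.br P.ad p →ₗ[ℝ]
        LieCochain.Cohomology P.br (P.adTilde A) p,
      ∀ (η : PoissonStructure.Form n M p) (hη : η ∈ LieCochain.cocycles P.br P.ad p),
        ∃ hηA : PoissonStructure.prolongForm A η ∈ LieCochain.cocycles P.br (P.adTilde A) p,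
          Φ (Submodule.Quotient.mk ⟨η, hη⟩) =
            Submodule.Quotient.mk ⟨PoissonStructure.prolongForm A η, hηA⟩) := by
  refine ⟨fun p η hη => P.prolongForm_mem_cocycles A hη,
    fun p η η' ν h => P.prolongForm_sub_eq_dTilde A h, fun p => ?_⟩
  refine ⟨Submodule.mapQ _ _ (P.prolongCocycle A p)
    fun η hη => P.prolongForm_mem_coboundaries A hη,
    fun η hη => ⟨P.prolongForm_mem_cocycles A hη, rfl⟩, fun Φ hΦ => ?_⟩
  refine LinearMap.ext fun q => ?_
  obtain ⟨⟨η, hη⟩, rfl⟩ := Submodule.Quotient.mk_surjective _ q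
  obtain ⟨_, h⟩ := hΦ η hη
  exact h
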